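/- **Setting.** Let $S$ be a set (of colours). A *tree* is a finite rooted full binary tree with interior vertices coloured by $S$; a *forest* is a finite list of trees; $Y_a$ is the tree with one interior vertex, coloured $a\in S$. Forests $f:r\leftarrow l$ ($r$ roots, $l$ leaves) compose vertically ($f\circ g$: glue the $i$th tree of $g$ to the $i$th leaf of $f$) and horizontally ($\otimes$, concatenation). Let $R$ be a set of pairs of trees $(t,s)$ with the same number of leaves, and let $\mathcal F=\mathrm{FS}\langle S\mid R\rangle$ be the quotient of the monoidal category of forests by the smallest congruence (for $\circ$ and $\otimes$) containing $R$. Assume that $\mathcal F$ is *Ore* (left-cancellative, $f\circ p=f\circ q\Rightarrow p=q$, with common right multiples) and *simple* (every surjective, leaf-number preserving monoidal functor from $\mathcal F$ onto a left-cancellative category of the same kind is an isomorphism). Let $\mathfrak C=\varprojlim_t \mathrm{Leaf}(t)$ be the profinite space of coherent choices of a leaf of every tree $t$ of $\mathcal F$, where $\mathrm{Leaf}(t\circ f)\to\mathrm{Leaf}(t)$ sends a leaf to the leaf of $t$ below it, ordered by $x\le y$ iff $x(t)\le y(t)$ eventually in $t$; let $o=\min\mathfrak C$ and $\omega=\max\mathfrak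 C$. Pointed trees $(t,i)$ (a tree of $\mathcal F$ with a distinguished leaf) form a monoid under gluing at the distinguished leaf, which acts on $\mathfrak C$ by $\beta(t,i)(w)(t\circ p)=$ the leaf $w(p_i)$ of the $i$th tree $p_i$ of $p$. Let $\mathcal T_o$ (resp. $\mathcal T_\omega$) be the submonoid of trees pointed at their first (resp. last) leaf. Let $G=G^F=\mathrm{Frac}(\mathcal F,1)$ be the group of fractions $[t,s]=t\circ s^{-1}$ of trees $t,s$ with the same number of leaves, acting on $\mathfrak C$ by homeomorphisms through $\alpha([t,s])\big((s,j)\cdot w\big)=(t,j)\cdot w$, where $(t,j)\cdot w=\beta(t,j)(w)$. Similarly the groups $G^T\subset G^V$ of fractions $[t,\pi,s]$, with $\pi$ a cyclic, resp. arbitrary, permutation of the leaves, act by $(s,j)\cdot w\mapsto(t,\pi(j))\cdot w$. For a group $\Gamma$ acting on $\mathfrak C$ by homeomorphisms, $\mathrm{Germ}(\Gamma\curvearrowright\mathfrak C;z)$ is the stabiliser of $z$ modulo the elements acting trivially on a neighbourhood of $z$. For a coloured tree $t$ let $\mathrm{prune}_o(t)$ (resp. $\mathrm{prune}_\omega(t)$)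 be the word of colours read from the root to the first (resp. last) leaf of $t$. For $\chi\in\{o,\omega\}$ put $$\Gamma_\chi=\mathrm{Gr}\langle S\mid \mathrm{prune}_\chi(t)=\mathrm{prune}_\chi(s),\ (t,s)\in R\rangle .$$ **Proposition.** For each $\chi\in\{o,\omega\}$ the following hold. 1. The monoid of transformations $\beta(\mathcal T_\chi)$ is left-cancellative and has common right multiples, i.e. it is an Ore monoid. 2. The map $a\mapsto\beta(Y_a,\chi)$ ($Y_a$ pointed at its first leaf if $\chi=o$, at its last leaf if $\chi=\omega$) induces a group isomorphism $\kappa_\chi:\Gamma_\chi\to\mathrm{Frac}(\beta(\mathcal T_\chi))$. 3. There is a surjective group morphism $\mathrm{prune}_\chi:G\to\Gamma_\chi$, $[t,s]\mapsto\mathrm{prune}_\chi(t)\,\mathrm{prune}_\chi(s)^{-1}$; the group $G$ fixes $\chi$; and $\kappa_\chi\circ\mathrm{prune}_\chi$ factors through an isomorphism $\mathrm{Germ}(G\curvearrowright\mathfrak C;\chi)\to\mathrm{Frac}(\beta(\mathcal T_\chi))$. In particular $\mathrm{Germ}(G\curvearrowright\mathfrak C;\chi)\cong\Gamma_\chi$.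 Moreover $\mathrm{Germ}(\Gamma\curvearrowright\mathfrak C;\chi)\cong\Gamma_\chi$ also for $\Gamma=G^T,\ G^V,\ [G^T,G^T],\ [G^V,G^V]$. -/

import Mathlib

universe u v w

open CategoryTheory

/-! ## Ore categories and their fraction groups -/

/-- A category is left-cancellative if `f ∘ p = f ∘ q` implies `p = q`. -/
class IsLeftCancellative (D : Type u) [Category.{v} D] : Prop where
  left_cancel : ∀ {a b c : D} (f : a ⟶ b) {p q : b ⟶ c}, f ≫ p = f ≫ q → p = q

/-- A left-cancellative category with common right multiples. -/
class OreCategory (D : Type u) [Category.{v} D] : Prop extends IsLeftCancellative D where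
  common_right_multiple : ∀ {a b c : D} (g : a ⟶ b) (h : a ⟶ c),
    ∃ (d : D) (k : b ⟶ d) (l : c ⟶ d), g ≫ k = h ≫ l

section Frac

variable {D : Type u} [Category.{v} D]

/-- Pairs `(f, g)` of parallel morphisms starting at `d`. -/
structure FracPair (d : D) where
  obj : D
  num : d ⟶ obj
  den : d ⟶ obj

/-- Two pairs are equivalent if they have a common expansion
`(f ∘ p, g ∘ p) = (f' ∘ q, g' ∘ q)`. -/
def FracRel {d : D} (a b : FracPair d) : Prop :=
  ∃ (z : D) (p : a.obj ⟶ z) (q : b.obj ⟶ z), a.num ≫ p = b.num ≫ q ∧ a.den ≫ p = b.den ≫ q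

theorem FracRel.expand {d : D} (a : FracPair d) {z : D} (p : a.obj ⟶ z) :
    FracRel a ⟨z, a.num ≫ p, a.den ≫ p⟩ :=
  ⟨z, p, 𝟙 z, by simp, by simp⟩

variable [OreCategory D]

theorem FracRel.equivalence (d : D) : Equivalence (FracRel (d := d)) where
  refl a := ⟨_, 𝟙 _, 𝟙 _, rfl, rfl⟩
  symm := fun ⟨z, p, q, h1, h2⟩ => ⟨z, q, p, h1.symm, h2.symm⟩
  trans := by
    rintro a b c ⟨z, p, q, h1, h2⟩ ⟨z', p', q', h1', h2'⟩
    obtain ⟨w, k, l, hkl⟩ := OreCategory.common_right_multiple q p'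
    refine ⟨w, p ≫ k, q' ≫ l, ?_, ?_⟩
    · rw [← Category.assoc, h1, Category.assoc, hkl, ← Category.assoc, h1', Category.assoc]
    · rw [← Category.assoc, h2, Category.assoc, hkl, ← Category.assoc, h2', Category.assoc]

/-- In an Ore category, `FracRel` is the equivalence relation generated by all
`(f, g) ∼ (f ∘ p, g ∘ p)`. -/
theorem fracRel_iff_eqvGen {d : D} (a b : FracPair d) :
    FracRel a b ↔ Relation.EqvGen
      (fun a b : FracPair d => ∃ p : a.obj ⟶ b.obj, b.num = a.num ≫ p ∧ b.den = a.den ≫ p) a b := by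
  constructor
  · rintro ⟨z, p, q, h1, h2⟩
    exact .trans _ ⟨z, a.num ≫ p, a.den ≫ p⟩ _ (.rel _ _ ⟨p, rfl, rfl⟩)
      (.symm _ _ (.rel _ _ ⟨q, h1, h2⟩))
  · intro h
    induction h with
    | rel a b h =>
      obtain ⟨p, h1, h2⟩ := h
      exact ⟨_, p, 𝟙 _, by simp [h1], by simp [h2]⟩
    | refl a => exact (FracRel.equivalence d).refl a
    | symm a b _ ih => exact (FracRel.equivalence d).symm ih
    | trans a b c _ _ ih1 ih2 => exact (FracRel.equivalence d).trans ih1 ih2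

/-- The setoid of pairs at `d`. -/
def fracSetoid (d : D) : Setoid (FracPair d) := ⟨FracRel, FracRel.equivalence d⟩

/-- The isotropy group `Frac(D, d)` at the object `d` of the fraction groupoid of the
Ore category `D`. -/
def FracGroup (D : Type u) [Category.{v} D] [OreCategory D] (d : D) : Type (max u v) :=
  Quotient (fracSetoid d)

namespace FracGroup

/-- The fraction `[f, g] = f ∘ g⁻¹`. -/
def mk {d x : D} (f g : d ⟶ x) : FracGroup D d := Quotient.mk (fracSetoid d) ⟨x, f, g⟩

theorem mk_eq_mk {d x y : D} {f g : d ⟶ x} {f' g' : d ⟶ y} :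
    mk f g = mk f' g' ↔ ∃ (z : D) (p : x ⟶ z) (q : y ⟶ z), f ≫ p = f' ≫ q ∧ g ≫ p = g' ≫ q :=
  Quotient.eq (r := fracSetoid d)

theorem mk_expand {d x z : D} (f g : d ⟶ x) (p : x ⟶ z) : mk (f ≫ p) (g ≫ p) = mk f g :=
  mk_eq_mk.2 ⟨z, 𝟙 z, p, by simp, by simp⟩

theorem ind {d : D} {C : FracGroup D d → Prop} (h : ∀ (x : D) (f g : d ⟶ x), C (mk f g))
    (a : FracGroup D d) : C a :=
  Quotient.ind (fun a => h a.obj a.num a.den) a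

theorem mul_aux {d : D} {a a' b b' : FracPair d} (ha : FracRel a a') (hb : FracRel b b')
    {z z' : D} {p : a.obj ⟶ z} {q : b.obj ⟶ z} {p' : a'.obj ⟶ z'} {q' : b'.obj ⟶ z'}
    (h : a.den ≫ p = b.num ≫ q) (h' : a'.den ≫ p' = b'.num ≫ q') :
    FracRel ⟨z, a.num ≫ p, b.den ≫ q⟩ ⟨z', a'.num ≫ p', b'.den ≫ q'⟩ := by
  obtain ⟨x, e, e', he1, he2⟩ := ha
  obtain ⟨y, s, s', hs1, hs2⟩ := hb
  obtain ⟨u, m, r0, h0⟩ := OreCategory.common_right_multiple e p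
  obtain ⟨v, r1, m1, h1⟩ := OreCategory.common_right_multiple (q ≫ r0) s
  obtain ⟨w, r2, r', h2⟩ := OreCategory.common_right_multiple (e' ≫ m ≫ r1) p'
  have key : b'.num ≫ (s' ≫ m1) ≫ r2 = b'.num ≫ q' ≫ r' := by
    have e1 : b'.num ≫ s' ≫ m1 = a'.den ≫ e' ≫ m ≫ r1 := by
      calc b'.num ≫ s' ≫ m1 = (b'.num ≫ s') ≫ m1 := by simp
        _ = b.num ≫ (q ≫ r0) ≫ r1 := by rw [← hs1, h1]; simp
        _ = (b.num ≫ q) ≫ r0 ≫ r1 := by simp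
        _ = a.den ≫ (p ≫ r0) ≫ r1 := by rw [← h]; simp
        _ = (a.den ≫ e) ≫ m ≫ r1 := by rw [← h0]; simp
        _ = _ := by rw [he2]; simp
    calc b'.num ≫ (s' ≫ m1) ≫ r2 = (b'.num ≫ s' ≫ m1) ≫ r2 := by simp
      _ = a'.den ≫ (e' ≫ m ≫ r1) ≫ r2 := by rw [e1]; simp
      _ = (a'.den ≫ p') ≫ r' := by rw [h2]; simp
      _ = _ := by rw [h']; simp
  have key2 := IsLeftCancellative.left_cancel _ key
  refine ⟨w, r0 ≫ r1 ≫ r2, r', ?_, ?_⟩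
  · calc (a.num ≫ p) ≫ r0 ≫ r1 ≫ r2 = a.num ≫ (p ≫ r0) ≫ r1 ≫ r2 := by simp
      _ = (a.num ≫ e) ≫ m ≫ r1 ≫ r2 := by rw [← h0]; simp
      _ = a'.num ≫ (e' ≫ m ≫ r1) ≫ r2 := by rw [he1]; simp
      _ = _ := by rw [h2]; simp
  · calc (b.den ≫ q) ≫ r0 ≫ r1 ≫ r2 = b.den ≫ ((q ≫ r0) ≫ r1) ≫ r2 := by simp
      _ = (b.den ≫ s) ≫ m1 ≫ r2 := by rw [h1]; simp
      _ = b'.den ≫ (s' ≫ m1) ≫ r2 := by rw [hs2]; simp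
      _ = _ := by rw [key2]; simp

/-- A chosen representative of the product of two fractions. -/
noncomputable def mulPair {d : D} (a b : FracPair d) : FracPair d :=
  let h := OreCategory.common_right_multiple a.den b.num
  ⟨h.choose, a.num ≫ h.choose_spec.choose, b.den ≫ h.choose_spec.choose_spec.choose⟩

/-- The product: `[f, g] · [h, k] = [f ∘ p, k ∘ q]` whenever `g ∘ p = h ∘ q`. -/
noncomputable instance (d : D) : Mul (FracGroup D d) where
  mul := Quotient.map₂ (sa := fracSetoid d) (sb := fracSetoid d) (sc := fracSetoid d) mulPair
    (fun a a' ha b b' hb => mul_aux ha hb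
      (OreCategory.common_right_multiple a.den b.num).choose_spec.choose_spec.choose_spec
      (OreCategory.common_right_multiple a'.den b'.num).choose_spec.choose_spec.choose_spec)

theorem mk_mul_mk {d x y z : D} {f g : d ⟶ x} {h k : d ⟶ y} {p : x ⟶ z} {q : y ⟶ z}
    (e : g ≫ p = h ≫ q) : mk f g * mk h k = mk (f ≫ p) (k ≫ q) :=
  Quotient.sound (s := fracSetoid d) (mul_aux (a := ⟨x, f, g⟩) (b := ⟨y, h, k⟩)
    ((FracRel.equivalence d).refl _) ((FracRel.equivalence d).refl _)
    (OreCategory.common_right_multiple g h).choose_spec.choose_spec.choose_spec e)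

instance (d : D) : One (FracGroup D d) where
  one := mk (𝟙 d) (𝟙 d)

instance (d : D) : Inv (FracGroup D d) where
  inv := Quotient.map (sa := fracSetoid d) (sb := fracSetoid d) (fun a => ⟨a.obj, a.den, a.num⟩)
    (fun _ _ ⟨z, p, q, h1, h2⟩ => ⟨z, p, q, h2, h1⟩)

theorem inv_mk {d x : D} (f g : d ⟶ x) : (mk f g)⁻¹ = mk g f := rfl

theorem mk_self {d x : D} (f : d ⟶ x) : mk f f = (1 : FracGroup D d) := by
  have := mk_expand (𝟙 d) (𝟙 d) f
  rw [Category.id_comp] at this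
  exact this

noncomputable instance (d : D) : Group (FracGroup D d) where
  mul_assoc a b c := by
    induction a using ind with | _ x f g
    induction b using ind with | _ y h k
    induction c using ind with | _ z l m
    obtain ⟨w, p, q, e1⟩ := OreCategory.common_right_multiple g h
    obtain ⟨v, r, s, e2⟩ := OreCategory.common_right_multiple (k ≫ q) l
    rw [mk_mul_mk e1, mk_mul_mk e2, mk_mul_mk (p := q ≫ r) (q := s) (by simpa using e2),
      mk_mul_mk (p := p ≫ r) (q := 𝟙 v)]
    · simp
    · simp only [Category.comp_id, ← Category.assoc, e1]
  one_mul a := by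
    induction a using ind with | _ x f g
    change mk (𝟙 d) (𝟙 d) * _ = _
    rw [mk_mul_mk (p := f) (q := 𝟙 x) (by simp)]; simp
  mul_one a := by
    induction a using ind with | _ x f g
    change _ * mk (𝟙 d) (𝟙 d) = _
    rw [mk_mul_mk (p := 𝟙 x) (q := g) (by simp)]; simp
  inv_mul_cancel a := by
    induction a using ind with | _ x f g
    rw [inv_mk, mk_mul_mk (p := 𝟙 x) (q := 𝟙 x) rfl, mk_self]

end FracGroup

end Frac

/-- A monoid viewed as a category with one object, in which `x ∘ y` is the product `x * y`. -/
structure OneObject (M : Type u) where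

instance (M : Type u) [Monoid M] : Category.{u, 0} (OneObject M) where
  Hom _ _ := M
  id _ := (1 : M)
  comp x y := (x * y : M)
  id_comp x := one_mul (M := M) x
  comp_id x := mul_one (M := M) x
  assoc x y z := mul_assoc (G := M) x y z

/-- An Ore monoid: a monoid which is left-cancellative and has common right multiples. -/
abbrev OreMonoid (M : Type u) [Monoid M] : Prop := OreCategory (OneObject M)

/-- The fraction group of an Ore monoid. -/
abbrev MonoidFrac (M : Type u) [Monoid M] [OreMonoid M] : Type u := FracGroup (OneObject M) ⟨⟩

/-- The fraction `[x, y] = x y⁻¹` of two elements of an Ore monoid. -/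
def MonoidFrac.mk {M : Type u} [Monoid M] [OreMonoid M] (x y : M) : MonoidFrac M :=
  FracGroup.mk (D := OneObject M) (d := ⟨⟩) (x := ⟨⟩) x y

/-! ## Germ groups -/

section Germ

variable {Γ : Type u} [Group Γ] {Z : Type v} [TopologicalSpace Z]

/-- The stabiliser of `z` for an action `η` by homeomorphisms. -/
def germStabilizer (η : Γ →* (Z ≃ₜ Z)) (z : Z) : Subgroup Γ where
  carrier := {g | η g z = z}
  one_mem' := by simp
  mul_mem' {g h} hg hh := by
    change η (g * h) z = z
    rw [map_mul]
    change η g (η h z) = z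
    rw [show η h z = z from hh]; exact hg
  inv_mem' {g} hg := by
    change η g⁻¹ z = z
    rw [map_inv]
    exact (Equiv.symm_apply_eq (η g).toEquiv).2 (Eq.symm hg)

/-- The elements of the stabiliser of `z` that act trivially on a neighbourhood of `z`. -/
def germKernel (η : Γ →* (Z ≃ₜ Z)) (z : Z) : Subgroup (germStabilizer η z) where
  carrier := {g | ∀ᶠ y in nhds z, η g y = y}
  one_mem' := by simp
  mul_mem' {g h} hg hh := by
    filter_upwards [hg, hh] with y h1 h2
    rw [Subgroup.coe_mul, map_mul]
    change η g (η h y) = y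
    rw [h2, h1]
  inv_mem' {g} hg := by
    filter_upwards [hg] with y h1
    rw [Subgroup.coe_inv, map_inv]
    exact (Equiv.symm_apply_eq (η g).toEquiv).2 (Eq.symm h1)

instance (η : Γ →* (Z ≃ₜ Z)) (z : Z) : (germKernel η z).Normal where
  conj_mem n hn g := by
    have h1 : (η (g⁻¹ : germStabilizer η z)) z = z := (g⁻¹).2
    have hc : Filter.Tendsto (η (g⁻¹ : germStabilizer η z)) (nhds z) (nhds z) := by
      have := (η (g⁻¹ : germStabilizer η z)).continuous.tendsto z
      rwa [h1] at this
    filter_upwards [hc.eventually hn] with y hy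
    have e : η ((g * n * g⁻¹ : germStabilizer η z) : Γ) y
        = η g (η n (η (g⁻¹ : germStabilizer η z) y)) := by
      simp only [Subgroup.coe_mul, map_mul]; rfl
    rw [e, hy, Subgroup.coe_inv, map_inv]
    exact (η g).toEquiv.apply_symm_apply y

/-- The germ group at `z`: germs at `z` of the group elements fixing `z`, where two elements have
the same germ when they agree on a neighbourhood of `z`. -/
def Germ (η : Γ →* (Z ≃ₜ Z)) (z : Z) : Type u := germStabilizer η z ⧸ germKernel η z

instance (η : Γ →* (Z ≃ₜ Z)) (z : Z) : Group (Germ η z) :=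
  inferInstanceAs (Group (germStabilizer η z ⧸ germKernel η z))

/-- The germ at `z` of an element fixing `z`. -/
def Germ.mk (η : Γ →* (Z ≃ₜ Z)) (z : Z) (g : Γ) (hg : η g z = z) : Germ η z :=
  QuotientGroup.mk (s := germKernel η z) ⟨g, hg⟩

theorem Germ.mk_eq_mk (η : Γ →* (Z ≃ₜ Z)) (z : Z) {g h : Γ} (hg : η g z = z) (hh : η h z = z) :
    Germ.mk η z g hg = Germ.mk η z h hh ↔ ∀ᶠ y in nhds z, η g y = η h y := by
  refine QuotientGroup.eq.trans ⟨fun H => ?_, fun H => ?_⟩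
  · filter_upwards [show ∀ᶠ y in nhds z, η (g⁻¹ * h) y = y from H] with y hy
    rw [map_mul, map_inv] at hy
    exact ((Equiv.symm_apply_eq (η g).toEquiv).1 hy).symm
  · change ∀ᶠ y in nhds z, η (g⁻¹ * h) y = y
    filter_upwards [H] with y hy
    rw [map_mul, map_inv]
    exact (Equiv.symm_apply_eq (η g).toEquiv).2 hy.symm

end Germ

/-! ## Free forests -/

/-- Finite rooted full binary trees with interior vertices coloured by `S`. -/
inductive FreeTree (S : Type u) : Type u
  | triv : FreeTree S
  | caret (a : S) (l r : FreeTree S) : FreeTree S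

namespace FreeTree

variable {S : Type u}

/-- The number of leaves. -/
def leaves : FreeTree S → ℕ
  | triv => 1
  | caret _ l r => l.leaves + r.leaves

/-- `t.graft g` is the tree `t ∘ g` obtained by gluing the `i`th tree of the forest `g` to the
`i`th leaf of `t` (used for forests `g` with as many roots as `t` has leaves). -/
def graft : FreeTree S → List (FreeTree S) → FreeTree S
  | triv, g => g.headD triv
  | caret a l r, g => caret a (l.graft (g.take l.leaves)) (r.graft (g.drop l.leaves))

theorem leaves_pos (t : FreeTree S) : 0 < t.leaves := by
  induction t with
  | triv => exact Nat.one_pos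
  | caret a l r hl hr => exact Nat.add_pos_left hl _

end FreeTree

namespace FreeForest

variable {S : Type u}

/-- The number of leaves of a forest (a list of trees). -/
def leaves (f : List (FreeTree S)) : ℕ := (f.map FreeTree.leaves).sum

/-- Vertical concatenation `f ∘ g`. -/
def comp : List (FreeTree S) → List (FreeTree S) → List (FreeTree S)
  | [], _ => []
  | t :: f, g => t.graft (g.take t.leaves) :: comp f (g.drop t.leaves)

@[simp] theorem leaves_nil : leaves ([] : List (FreeTree S)) = 0 := rfl
@[simp] theorem leaves_cons (t : FreeTree S) (f : List (FreeTree S)) :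
    leaves (t :: f) = t.leaves + leaves f := by simp [leaves]
@[simp] theorem leaves_append (f g : List (FreeTree S)) :
    leaves (f ++ g) = leaves f + leaves g := by simp [leaves]

theorem leaves_take_add_drop (g : List (FreeTree S)) (k : ℕ) :
    leaves (g.take k) + leaves (g.drop k) = leaves g := by
  rw [← leaves_append, List.take_append_drop]

@[simp] theorem length_comp (f g : List (FreeTree S)) : (comp f g).length = f.length := by
  induction f generalizing g with
  | nil => rfl
  | cons t f ih => simp [comp, ih]

theorem leaves_graft (t : FreeTree S) (g : List (FreeTree S)) (h : g.length = t.leaves) :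
    (t.graft g).leaves = leaves g := by
  induction t generalizing g with
  | triv =>
    match g, h with
    | [a], _ => simp [FreeTree.graft]
  | caret a l r hl hr =>
    simp only [FreeTree.leaves] at h
    simp only [FreeTree.graft, FreeTree.leaves]
    rw [hl _ (by rw [List.length_take]; omega), hr _ (by rw [List.length_drop]; omega),
      leaves_take_add_drop]

theorem leaves_comp (f g : List (FreeTree S)) (h : g.length = leaves f) :
    leaves (comp f g) = leaves g := by
  induction f generalizing g with
  | nil =>
    have : g = [] := List.length_eq_zero_iff.1 h
    simp [comp, this]
  | cons t f ih =>
    simp only [leaves_cons] at h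
    simp only [comp, leaves_cons]
    rw [leaves_graft _ _ (by rw [List.length_take]; omega),
      ih _ (by rw [List.length_drop]; omega), leaves_take_add_drop]

theorem comp_append (f f' h : List (FreeTree S)) :
    comp (f ++ f') h = comp f (h.take (leaves f)) ++ comp f' (h.drop (leaves f)) := by
  induction f generalizing h with
  | nil => simp [comp]
  | cons t f ih =>
    simp only [List.cons_append, comp, leaves_cons, ih, List.take_take, List.drop_drop,
      List.drop_take]
    simp

theorem take_comp (g h : List (FreeTree S)) (k : ℕ) :
    (comp g h).take k = comp (g.take k) (h.take (leaves (g.take k))) := by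
  induction g generalizing h k with
  | nil => simp [comp]
  | cons t g ih =>
    cases k with
    | zero => simp [comp]
    | succ k => simp [comp, ih, List.take_take, List.drop_take]

theorem drop_comp (g h : List (FreeTree S)) (k : ℕ) :
    (comp g h).drop k = comp (g.drop k) (h.drop (leaves (g.take k))) := by
  induction g generalizing h k with
  | nil => simp [comp]
  | cons t g ih =>
    cases k with
    | zero => simp [comp]
    | succ k => simp [comp, ih, List.drop_drop]

theorem graft_graft (t : FreeTree S) (g h : List (FreeTree S)) (hg : g.length = t.leaves)
    (hh : h.length = leaves g) : (t.graft g).graft h = t.graft (comp g h) := by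
  induction t generalizing g h with
  | triv =>
    match g, hg with
    | [a], _ =>
      have : h.take a.leaves = h := List.take_of_length_le (by simp at hh; omega)
      simp [FreeTree.graft, comp, this]
  | caret a l r hl hr =>
    simp only [FreeTree.leaves] at hg
    have e := leaves_take_add_drop g l.leaves
    have e1 : (g.take l.leaves).length = l.leaves := by rw [List.length_take]; omega
    have e2 : (g.drop l.leaves).length = r.leaves := by rw [List.length_drop]; omega
    simp only [FreeTree.graft, leaves_graft _ _ e1, take_comp, drop_comp]
    rw [hl _ _ e1 (by rw [List.length_take]; omega), hr _ _ e2 (by rw [List.length_drop]; omega)]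

theorem comp_assoc (f g h : List (FreeTree S)) (hg : g.length = leaves f)
    (hh : h.length = leaves g) : comp (comp f g) h = comp f (comp g h) := by
  induction f generalizing g h with
  | nil => simp [comp]
  | cons t f ih =>
    simp only [leaves_cons] at hg
    have e := leaves_take_add_drop g t.leaves
    have e1 : (g.take t.leaves).length = t.leaves := by rw [List.length_take]; omega
    have e2 : (g.drop t.leaves).length = leaves f := by rw [List.length_drop]; omega
    simp only [comp, leaves_graft _ _ e1, take_comp, drop_comp]
    rw [graft_graft _ _ _ e1 (by rw [List.length_take]; omega),
      ih _ _ e2 (by rw [List.length_drop]; omega)]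

theorem graft_triv (t : FreeTree S) : t.graft (List.replicate t.leaves .triv) = t := by
  induction t with
  | triv => rfl
  | caret a l r hl hr =>
    simp [FreeTree.graft, FreeTree.leaves, List.take_replicate, List.drop_replicate, hl, hr]

theorem comp_triv (f : List (FreeTree S)) : comp f (List.replicate (leaves f) .triv) = f := by
  induction f with
  | nil => rfl
  | cons t f ih =>
    simp [comp, List.take_replicate, List.drop_replicate, ih, graft_triv]

theorem triv_comp (g : List (FreeTree S)) : comp (List.replicate g.length .triv) g = g := by
  induction g with
  | nil => rfl
  | cons t g ih => simp [comp, List.replicate_succ, FreeTree.graft, FreeTree.leaves, ih]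

end FreeForest

/-! ## Skein presentations and forest-skein categories -/

/-- A skein presentation over the colour set `S`: a set of pairs of coloured trees having the same
number of leaves. -/
structure SkeinPresentation (S : Type u) where
  rel : FreeTree S → FreeTree S → Prop
  leaves_eq : ∀ {t s : FreeTree S}, rel t s → t.leaves = s.leaves

/-- The smallest equivalence relation on free forests which contains the skein relations and is
closed under vertical composition and horizontal concatenation. -/
inductive SkeinEq {S : Type u} (P : SkeinPresentation S) :
    List (FreeTree S) → List (FreeTree S) → Prop
  | rel {t s : FreeTree S} : P.rel t s → SkeinEq P [t] [s]
  | refl (f : List (FreeTree S)) : SkeinEq P f f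
  | symm {f g : List (FreeTree S)} : SkeinEq P f g → SkeinEq P g f
  | trans {f g h : List (FreeTree S)} : SkeinEq P f g → SkeinEq P g h → SkeinEq P f h
  | comp {f f' g g' : List (FreeTree S)} : SkeinEq P f f' → SkeinEq P g g' →
      g.length = FreeForest.leaves f → SkeinEq P (FreeForest.comp f g) (FreeForest.comp f' g')
  | tensor {f f' g g' : List (FreeTree S)} : SkeinEq P f f' → SkeinEq P g g' →
      SkeinEq P (f ++ g) (f' ++ g')

namespace SkeinEq

variable {S : Type u} {P : SkeinPresentation S}

theorem length_leaves {f g : List (FreeTree S)} (h : SkeinEq P f g) :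
    f.length = g.length ∧ FreeForest.leaves f = FreeForest.leaves g := by
  induction h with
  | rel h => simp [P.leaves_eq h]
  | refl f => exact ⟨rfl, rfl⟩
  | symm _ ih => exact ⟨ih.1.symm, ih.2.symm⟩
  | trans _ _ ih1 ih2 => exact ⟨ih1.1.trans ih2.1, ih1.2.trans ih2.2⟩
  | comp h1 h2 h ih1 ih2 =>
    refine ⟨by simp [ih1.1], ?_⟩
    rw [FreeForest.leaves_comp _ _ h, FreeForest.leaves_comp _ _ (by omega), ih2.2]
  | tensor _ _ ih1 ih2 => simp [ih1, ih2]

theorem of_forall₂ {f g : List (FreeTree S)}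
    (h : List.Forall₂ (fun t s => SkeinEq P [t] [s]) f g) : SkeinEq P f g := by
  induction h with
  | nil => exact refl _
  | cons h _ ih => exact tensor h ih

theorem leaves_eq {t s : FreeTree S} (h : SkeinEq P [t] [s]) : t.leaves = s.leaves := by
  simpa using h.length_leaves.2

theorem graft {t t' : FreeTree S} {g g' : List (FreeTree S)} (ht : SkeinEq P [t] [t'])
    (hg : SkeinEq P g g') (h : g.length = t.leaves) :
    SkeinEq P [t.graft g] [t'.graft g'] := by
  have := comp ht hg (by simpa using h)
  have e := hg.length_leaves.1
  have e' := ht.leaves_eq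
  simpa [FreeForest.comp, List.take_of_length_le (le_of_eq h),
    List.take_of_length_le (show g'.length ≤ t'.leaves by omega)] using this

theorem forall₂ {f g : List (FreeTree S)} (h : SkeinEq P f g) :
    List.Forall₂ (fun t s => SkeinEq P [t] [s]) f g := by
  induction h with
  | rel h => exact .cons (rel h) .nil
  | refl f => exact List.forall₂_same.2 fun t _ => refl _
  | symm _ ih => exact ih.flip.imp fun _ _ h => symm h
  | trans _ _ ih1 ih2 =>
    clear * - ih1 ih2
    rename_i f g h
    induction ih1 generalizing h with
    | nil => exact ih2
    | cons h1 _ ih =>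
      cases ih2 with
      | cons h2 h3 => exact .cons (trans h1 h2) (ih h3)
  | comp _ _ h ih1 ih2 =>
    clear * - ih1 ih2 h
    rename_i f f' g g'
    induction ih1 generalizing g g' with
    | nil => exact .nil
    | cons h1 _ ih =>
      simp only [FreeForest.leaves_cons] at h
      simp only [FreeForest.comp]
      rw [← h1.leaves_eq]
      refine .cons (graft h1 (of_forall₂ (List.forall₂_take _ ih2)) ?_)
        (ih ?_ (List.forall₂_drop _ ih2))
      · rw [List.length_take]; omega
      · rw [List.length_drop]; omega
  | tensor _ _ ih1 ih2 => exact List.rel_append ih1 ih2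

/-- The congruence on forests is determined by its restriction to trees: two free forests are
equivalent exactly when they have the same number of trees and corresponding trees are
equivalent. So the quotient consists of finite lists of classes of trees. -/
theorem iff_forall₂ {f g : List (FreeTree S)} :
    SkeinEq P f g ↔ List.Forall₂ (fun t s => SkeinEq P [t] [s]) f g :=
  ⟨forall₂, of_forall₂⟩

end SkeinEq

section

variable {S : Type u} (P : SkeinPresentation S)

/-- Equivalence of trees. -/
def treeSetoid : Setoid (FreeTree S) where
  r t s := SkeinEq P [t] [s]
  iseqv := ⟨fun _ => .refl _, .symm, .trans⟩

/-- The set of trees of the forest-skein category. -/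
def FSTree : Type u := Quotient (treeSetoid P)

end

namespace FSTree

variable {S : Type u} {P : SkeinPresentation S}

/-- The class of a free tree. -/
def mk (P : SkeinPresentation S) (t : FreeTree S) : FSTree P := Quotient.mk (treeSetoid P) t

theorem mk_eq_mk {t s : FreeTree S} : mk P t = mk P s ↔ SkeinEq P [t] [s] :=
  Quotient.eq (r := treeSetoid P)

theorem ind {C : FSTree P → Prop} (h : ∀ t, C (mk P t)) (t : FSTree P) : C t := Quotient.ind h t

/-- A representative. -/
noncomputable def rep (t : FSTree P) : FreeTree S := Quotient.out (s := treeSetoid P) t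

theorem mk_rep (t : FSTree P) : mk P t.rep = t := Quotient.out_eq (s := treeSetoid P) t

/-- The number of leaves. -/
def leaves : FSTree P → ℕ :=
  Quotient.lift (s := treeSetoid P) FreeTree.leaves fun _ _ h => SkeinEq.leaves_eq h

@[simp] theorem leaves_mk (t : FreeTree S) : (mk P t).leaves = t.leaves := rfl
@[simp] theorem leaves_rep (t : FSTree P) : t.rep.leaves = t.leaves := by
  conv_rhs => rw [← mk_rep t, leaves_mk]

theorem leaves_pos (t : FSTree P) : 0 < t.leaves := by
  rw [← leaves_rep]; exact FreeTree.leaves_pos _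

/-- The trivial tree. -/
def triv (P : SkeinPresentation S) : FSTree P := mk P .triv

@[simp] theorem leaves_triv : (triv P).leaves = 1 := rfl

/-- `t.graft g` is the tree `t ∘ g`, computed on representatives. -/
noncomputable def graft (t : FSTree P) (g : List (FSTree P)) : FSTree P :=
  mk P (t.rep.graft (g.map rep))

end FSTree

namespace Forest

variable {S : Type u} {P : SkeinPresentation S}

/-- The number of leaves of a forest. -/
def leaves (f : List (FSTree P)) : ℕ := (f.map FSTree.leaves).sum

@[simp] theorem leaves_nil : leaves ([] : List (FSTree P)) = 0 := rfl
@[simp] theorem leaves_cons (t : FSTree P) (f : List (FSTree P)) :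
    leaves (t :: f) = t.leaves + leaves f := by simp [leaves]
@[simp] theorem leaves_append (f g : List (FSTree P)) :
    leaves (f ++ g) = leaves f + leaves g := by simp [leaves]
@[simp] theorem leaves_replicate_triv (n : ℕ) : leaves (List.replicate n (FSTree.triv P)) = n := by
  simp [leaves]

theorem leaves_map_mk (f : List (FreeTree S)) :
    leaves (f.map (FSTree.mk P)) = FreeForest.leaves f := by
  simp [leaves, FreeForest.leaves, Function.comp_def]

/-- Vertical concatenation `f ∘ g` in the forest-skein category. -/
noncomputable def comp : List (FSTree P) → List (FSTree P) → List (FSTree P)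
  | [], _ => []
  | t :: f, g => t.graft (g.take t.leaves) :: comp f (g.drop t.leaves)

theorem mk_rep (f : List (FSTree P)) : (f.map FSTree.rep).map (FSTree.mk P) = f := by
  simp [Function.comp_def, FSTree.mk_rep]

theorem graft_mk (t : FreeTree S) (g : List (FreeTree S)) (h : g.length = t.leaves) :
    (FSTree.mk P t).graft (g.map (FSTree.mk P)) = FSTree.mk P (t.graft g) := by
  refine FSTree.mk_eq_mk.2 (SkeinEq.graft (FSTree.mk_eq_mk.1 (FSTree.mk_rep _)) ?_ (by simp [h]))
  refine SkeinEq.of_forall₂ ?_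
  clear h
  induction g with
  | nil => exact .nil
  | cons s g ih => exact .cons (FSTree.mk_eq_mk.1 (FSTree.mk_rep _)) ih

theorem comp_mk (f g : List (FreeTree S)) (h : g.length = FreeForest.leaves f) :
    comp (f.map (FSTree.mk P)) (g.map (FSTree.mk P)) = (FreeForest.comp f g).map (FSTree.mk P) := by
  induction f generalizing g with
  | nil => rfl
  | cons t f ih =>
    simp only [FreeForest.leaves_cons] at h
    simp only [List.map_cons, comp, FreeForest.comp, FSTree.leaves_mk, ← List.map_take,
      ← List.map_drop]
    rw [graft_mk _ _ (by rw [List.length_take]; omega), ih _ (by rw [List.length_drop]; omega)]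

@[simp] theorem length_comp (f g : List (FSTree P)) : (comp f g).length = f.length := by
  induction f generalizing g with
  | nil => rfl
  | cons t f ih => simp [comp, ih]

theorem leaves_graft (t : FSTree P) (g : List (FSTree P)) (h : g.length = t.leaves) :
    (t.graft g).leaves = leaves g := by
  rw [FSTree.graft, FSTree.leaves_mk, FreeForest.leaves_graft _ _ (by simp [h]),
    ← leaves_map_mk (P := P), mk_rep]

theorem leaves_comp (f g : List (FSTree P)) (h : g.length = leaves f) :
    leaves (comp f g) = leaves g := by
  rw [← mk_rep f, leaves_map_mk] at h
  rw [← mk_rep f, ← mk_rep g, comp_mk _ _ (by simpa using h), leaves_map_mk, leaves_map_mk,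
    FreeForest.leaves_comp _ _ (by simpa using h)]

theorem graft_graft (t : FSTree P) (g h : List (FSTree P)) (hg : g.length = t.leaves)
    (hh : h.length = leaves g) : (t.graft g).graft h = t.graft (comp g h) := by
  obtain ⟨h, rfl⟩ : ∃ h', List.map (FSTree.mk P) h' = h := ⟨_, mk_rep h⟩
  obtain ⟨g, rfl⟩ : ∃ g', List.map (FSTree.mk P) g' = g := ⟨_, mk_rep g⟩
  induction t using FSTree.ind with | _ t
  simp only [List.length_map, FSTree.leaves_mk, leaves_map_mk] at hg hh
  rw [graft_mk _ _ hg, graft_mk _ _ (by rw [FreeForest.leaves_graft _ _ hg, hh]), comp_mk _ _ hh,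
    graft_mk _ _ (by simp [hg]), FreeForest.graft_graft _ _ _ hg hh]

theorem comp_assoc (f g h : List (FSTree P)) (hg : g.length = leaves f)
    (hh : h.length = leaves g) : comp (comp f g) h = comp f (comp g h) := by
  obtain ⟨h, rfl⟩ : ∃ h', List.map (FSTree.mk P) h' = h := ⟨_, mk_rep h⟩
  obtain ⟨g, rfl⟩ : ∃ g', List.map (FSTree.mk P) g' = g := ⟨_, mk_rep g⟩
  obtain ⟨f, rfl⟩ : ∃ f', List.map (FSTree.mk P) f' = f := ⟨_, mk_rep f⟩
  simp only [List.length_map, leaves_map_mk] at hg hh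
  rw [comp_mk _ _ hg, comp_mk _ _ hh, comp_mk _ _ (by rw [FreeForest.leaves_comp _ _ hg, hh]),
    comp_mk _ _ (by simp [hg]), FreeForest.comp_assoc _ _ _ hg hh]

theorem graft_triv (t : FSTree P) : t.graft (List.replicate t.leaves (FSTree.triv P)) = t := by
  induction t using FSTree.ind with | _ t
  rw [FSTree.triv, ← List.map_replicate, graft_mk _ _ (by simp), FSTree.leaves_mk,
    FreeForest.graft_triv]

theorem comp_triv (f : List (FSTree P)) :
    comp f (List.replicate (leaves f) (FSTree.triv P)) = f := by
  induction f with
  | nil => rfl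
  | cons t f ih => simp [comp, List.take_replicate, List.drop_replicate, ih, graft_triv]

/-- Forests are exactly the classes of free forests modulo the skein congruence. -/
theorem map_mk_eq_iff {f g : List (FreeTree S)} :
    f.map (FSTree.mk P) = g.map (FSTree.mk P) ↔ SkeinEq P f g := by
  rw [SkeinEq.iff_forall₂, ← List.forall₂_eq_eq_eq, List.forall₂_map_left_iff,
    List.forall₂_map_right_iff]
  simp only [FSTree.mk_eq_mk]

theorem triv_graft (t : FSTree P) : (FSTree.triv P).graft [t] = t := by
  induction t using FSTree.ind with | _ t
  exact graft_mk .triv [t] rfl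

theorem triv_comp (g : List (FSTree P)) :
    comp (List.replicate g.length (FSTree.triv P)) g = g := by
  induction g with
  | nil => rfl
  | cons t g ih => simp [comp, List.replicate_succ, triv_graft, ih]

end Forest

/-- The forest-skein category `FS⟨S | R⟩`. Its objects are the natural numbers. -/
structure FSCat {S : Type u} (P : SkeinPresentation S) : Type where
  num : ℕ

/-- Forests `f : r ← l` with `r` roots and `l` leaves. -/
def FSCat.Hom {S : Type u} (P : SkeinPresentation S) (r l : ℕ) : Type u :=
  {f : List (FSTree P) // f.length = r ∧ Forest.leaves f = l}

/-- The category structure: a morphism `r ⟶ l` is a forest with `r` roots and `l` leaves, and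
`f ≫ g` is the vertical concatenation `f ∘ g`. -/
noncomputable instance {S : Type u} (P : SkeinPresentation S) : Category.{u} (FSCat P) where
  Hom r l := FSCat.Hom P r.num l.num
  id r := ⟨List.replicate r.num (FSTree.triv P), by simp, by simp⟩
  comp f g := ⟨Forest.comp f.1 g.1, by simp [f.2.1],
    by rw [Forest.leaves_comp _ _ (by rw [g.2.1, f.2.2]), g.2.2]⟩
  id_comp f := Subtype.ext (by
    have := Forest.triv_comp f.1
    rwa [f.2.1] at this)
  comp_id f := Subtype.ext (by
    have := Forest.comp_triv f.1
    rwa [f.2.2] at this)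
  assoc f g h := Subtype.ext
    (Forest.comp_assoc f.1 g.1 h.1 (by rw [g.2.1, f.2.2]) (by rw [h.2.1, g.2.2]))

namespace FSCat

variable {S : Type u} {P : SkeinPresentation S}

/-- Horizontal concatenation. -/
def tensor {a b c d : ℕ} (f : (⟨a⟩ : FSCat P) ⟶ ⟨b⟩) (g : (⟨c⟩ : FSCat P) ⟶ ⟨d⟩) :
    (⟨a + c⟩ : FSCat P) ⟶ ⟨b + d⟩ :=
  ⟨f.1 ++ g.1, by rw [List.length_append, f.2.1, g.2.1],
    by rw [Forest.leaves_append, f.2.2, g.2.2]⟩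

/-- A tree with `n` leaves as a morphism from `1` to `n`. -/
def ofTree (t : FSTree P) {n : ℕ} (h : t.leaves = n) : (⟨1⟩ : FSCat P) ⟶ ⟨n⟩ :=
  ⟨[t], rfl, by simpa using h⟩

/-- The tree underlying a morphism from `1`. -/
def toTree {n : ℕ} (f : (⟨1⟩ : FSCat P) ⟶ ⟨n⟩) : FSTree P := f.1.headD (FSTree.triv P)

theorem val_eq {n : ℕ} (f : (⟨1⟩ : FSCat P) ⟶ ⟨n⟩) : f.1 = [toTree f] := by
  obtain ⟨f, h1, h2⟩ := f
  match f, h1 with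
  | [t], _ => rfl

theorem leaves_toTree {n : ℕ} (f : (⟨1⟩ : FSCat P) ⟶ ⟨n⟩) : (toTree f).leaves = n := by
  have := f.2.2
  rw [val_eq] at this
  simpa using this

theorem leaves_toTree_eq {n : ℕ} (f g : (⟨1⟩ : FSCat P) ⟶ ⟨n⟩) :
    (toTree f).leaves = (toTree g).leaves := by
  rw [leaves_toTree, leaves_toTree]

theorem toTree_comp {n m : ℕ} (f : (⟨1⟩ : FSCat P) ⟶ ⟨n⟩) (g : (⟨n⟩ : FSCat P) ⟶ ⟨m⟩) :
    toTree (f ≫ g) = (toTree f).graft g.1 := by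
  change (Forest.comp f.1 g.1).headD _ = _
  rw [val_eq f]
  have : g.1.take (toTree f).leaves = g.1 :=
    List.take_of_length_le (by rw [leaves_toTree, g.2.1])
  simp [Forest.comp, this]

end FSCat

/-- A morphism of forest-skein categories: a monoidal functor preserving the number of leaves
(hence the identity on objects). -/
structure FSMorphism {S S' : Type u} (P : SkeinPresentation S) (P' : SkeinPresentation S') where
  map : ∀ {m n : ℕ}, ((⟨m⟩ : FSCat P) ⟶ ⟨n⟩) → ((⟨m⟩ : FSCat P') ⟶ ⟨n⟩)
  map_id : ∀ n : ℕ, map (𝟙 (⟨n⟩ : FSCat P)) = 𝟙 (⟨n⟩ : FSCat P')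
  map_comp : ∀ {m n k : ℕ} (f : (⟨m⟩ : FSCat P) ⟶ ⟨n⟩) (g : (⟨n⟩ : FSCat P) ⟶ ⟨k⟩),
    map (f ≫ g) = map f ≫ map g
  map_tensor : ∀ {a b c d : ℕ} (f : (⟨a⟩ : FSCat P) ⟶ ⟨b⟩) (g : (⟨c⟩ : FSCat P) ⟶ ⟨d⟩),
    map (FSCat.tensor f g) = FSCat.tensor (map f) (map g)

/-- The forest-skein category is simple if none of its proper quotients is left-cancellative:
every surjective morphism onto a left-cancellative forest-skein category is injective. -/
def SkeinPresentation.IsSimple {S : Type u} (P : SkeinPresentation S) : Prop :=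
  ∀ (S' : Type u) (P' : SkeinPresentation S') (Φ : FSMorphism P P'),
    (∀ m n : ℕ, Function.Surjective (Φ.map (m := m) (n := n))) →
    IsLeftCancellative (FSCat P') →
    ∀ m n : ℕ, Function.Injective (Φ.map (m := m) (n := n))

/-! ## Leaves of forests -/

namespace Forest

variable {S : Type u} {P : SkeinPresentation S}

theorem leaves_take_add_drop (g : List (FSTree P)) (k : ℕ) :
    leaves (g.take k) + leaves (g.drop k) = leaves g := by
  rw [← leaves_append, List.take_append_drop]

theorem comp_append (f f' h : List (FSTree P)) :
    comp (f ++ f') h = comp f (h.take (leaves f)) ++ comp f' (h.drop (leaves f)) := by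
  induction f generalizing h with
  | nil => simp [comp]
  | cons t f ih =>
    simp only [List.cons_append, comp, leaves_cons, ih, List.take_take, List.drop_drop,
      List.drop_take]
    simp

/-- The number of leaves of the first `i` trees of a forest: the (zero-based) position of the first
leaf of the tree with (zero-based) index `i`. -/
def offset (f : List (FSTree P)) (i : ℕ) : ℕ := leaves (f.take i)

/-- The (zero-based) index of the tree of the forest `f` that contains the `k`th leaf of `f`. -/
def root : List (FSTree P) → ℕ → ℕ
  | [], _ => 0
  | t :: f, k => if k < t.leaves then 0 else root f (k - t.leaves) + 1

theorem root_lt (f : List (FSTree P)) (k : ℕ) (h : k < leaves f) : root f k < f.length := by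
  induction f generalizing k with
  | nil => simp at h
  | cons t f ih =>
    simp only [leaves_cons] at h
    simp only [root, List.length_cons]
    split_ifs with h1
    · omega
    · have := ih (k - t.leaves) (by omega)
      omega

theorem root_append (f g : List (FSTree P)) (k : ℕ) :
    root (f ++ g) k = if k < leaves f then root f k else f.length + root g (k - leaves f) := by
  induction f generalizing k with
  | nil => simp
  | cons t f ih =>
    simp only [List.cons_append, root, leaves_cons, ih, List.length_cons]
    by_cases h1 : k < t.leaves
    · rw [if_pos h1, if_pos h1, if_pos (by omega)]
    · rw [if_neg h1, if_neg h1]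
      by_cases h2 : k < t.leaves + leaves f
      · rw [if_pos h2, if_pos (by omega)]
      · rw [if_neg h2, if_neg (by omega), Nat.sub_sub]
        omega

theorem root_offset_add (g : List (FSTree P)) (m k : ℕ) (hm : m ≤ g.length) :
    root g (offset g m + k) = m + root (g.drop m) k := by
  conv_lhs => rw [← List.take_append_drop m g]
  rw [root_append, if_neg (by simp [offset]), List.length_take, min_eq_left hm,
    List.take_append_drop]
  simp [offset]

theorem root_take (g : List (FSTree P)) (m k : ℕ) (h : k < leaves (g.take m)) :
    root g k = root (g.take m) k := by
  conv_lhs => rw [← List.take_append_drop m g]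
  rw [root_append, if_pos h]

theorem root_comp (f g : List (FSTree P)) (k : ℕ) (h : g.length = leaves f) (hk : k < leaves g) :
    root f (root g k) = root (comp f g) k := by
  induction f generalizing g k with
  | nil => rfl
  | cons t f ih =>
    simp only [leaves_cons] at h
    have e := leaves_take_add_drop g t.leaves
    have e1 : (g.take t.leaves).length = t.leaves := by rw [List.length_take]; omega
    have e2 : (g.drop t.leaves).length = leaves f := by rw [List.length_drop]; omega
    simp only [comp, root, leaves_graft _ _ e1]
    by_cases h1 : k < leaves (g.take t.leaves)
    · have := root_lt _ _ h1
      rw [if_pos h1, root_take _ _ _ h1, if_pos (by omega)]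
    · have e3 : root g k = t.leaves + root (g.drop t.leaves) (k - leaves (g.take t.leaves)) := by
        rw [← root_offset_add _ _ _ (by omega)]
        congr 1
        simp only [offset]; omega
      rw [if_neg h1, e3, if_neg (by omega), ← ih _ _ e2 (by omega)]
      congr 2
      omega

theorem root_triv (n k : ℕ) (h : k < n) : root (List.replicate n (FSTree.triv P)) k = k := by
  induction n generalizing k with
  | zero => omega
  | succ n ih =>
    simp only [List.replicate_succ, root]
    have h1 : (FSTree.triv P).leaves = 1 := rfl
    by_cases h2 : k < (FSTree.triv P).leaves
    · rw [if_pos h2]; omega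
    · rw [if_neg h2, ih _ (by omega)]; omega

/-- The tree with (zero-based) index `i` of a forest. -/
def tree (f : List (FSTree P)) (i : ℕ) : FSTree P := f.getD i (FSTree.triv P)

theorem drop_eq_cons (f : List (FSTree P)) (i : ℕ) (h : i < f.length) :
    f.drop i = tree f i :: f.drop (i + 1) := by
  rw [List.drop_eq_getElem_cons h, tree, List.getD_eq_getElem _ _ h]

theorem offset_succ (f : List (FSTree P)) (i : ℕ) (h : i < f.length) :
    offset f (i + 1) = offset f i + (tree f i).leaves := by
  rw [offset, offset, tree, List.getD_eq_getElem _ _ h, List.take_succ_eq_append_getElem h,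
    leaves_append]
  simp

theorem offset_le (f : List (FSTree P)) (i : ℕ) : offset f i ≤ leaves f := by
  have := leaves_take_add_drop f i
  rw [offset]; omega

theorem offset_add_lt (f : List (FSTree P)) (i k : ℕ) (h : i < f.length)
    (hk : k < (tree f i).leaves) : offset f i + k < leaves f := by
  have := offset_succ f i h
  have := offset_le f (i + 1)
  omega

theorem offset_add (f : List (FSTree P)) (i j : ℕ) :
    offset f (i + j) = offset f i + offset (f.drop i) j := by
  simp [offset, List.take_add]

theorem tree_comp (f g : List (FSTree P)) (i : ℕ) (h : i < f.length) :
    tree (comp f g) i = (tree f i).graft ((g.drop (offset f i)).take (tree f i).leaves) := by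
  have e : comp f g = comp (f.take i ++ tree f i :: f.drop (i + 1)) g := by
    rw [← drop_eq_cons _ _ h, List.take_append_drop]
  have hl : (comp (f.take i) (g.take (leaves (f.take i)))).length = i := by
    rw [length_comp, List.length_take]; omega
  rw [e, comp_append, tree, List.getD_append_right _ _ _ _ (le_of_eq hl), hl, comp, Nat.sub_self]
  rfl

theorem offset_comp (f g : List (FSTree P)) (i : ℕ) (h : i ≤ f.length)
    (hg : g.length = leaves f) : offset (comp f g) i = offset g (offset f i) := by
  have hl : (comp (f.take i) (g.take (leaves (f.take i)))).length = i := by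
    rw [length_comp, List.length_take]; omega
  have e : comp f g = comp (f.take i ++ f.drop i) g := by rw [List.take_append_drop]
  have := leaves_take_add_drop f i
  rw [offset, e, comp_append, List.take_append_of_le_length (le_of_eq hl.symm),
    List.take_of_length_le (le_of_eq hl), leaves_comp _ _ (by rw [List.length_take]; omega)]
  rfl

/-- The forest `I ⊗ ⋯ ⊗ I ⊗ s ⊗ I ⊗ ⋯ ⊗ I` with `n` roots, the tree `s` having
(zero-based) index `i`. -/
def single (n i : ℕ) (s : FSTree P) : List (FSTree P) :=
  List.replicate i (FSTree.triv P) ++ s :: List.replicate (n - (i + 1)) (FSTree.triv P)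

theorem length_single {n i : ℕ} (h : i < n) (s : FSTree P) : (single n i s).length = n := by
  simp [single]; omega

theorem leaves_single (n i : ℕ) (s : FSTree P) :
    leaves (single n i s) = i + (s.leaves + (n - (i + 1))) := by
  simp [single]

theorem tree_single (n i : ℕ) (s : FSTree P) : tree (single n i s) i = s := by
  rw [tree, single, List.getD_append_right _ _ _ _ (by simp)]
  simp

theorem offset_single (n i : ℕ) (s : FSTree P) : offset (single n i s) i = i := by
  rw [offset, single, List.take_append_of_le_length (by simp)]
  simp

theorem single_triv {n i : ℕ} (h : i < n) :
    single n i (FSTree.triv P) = List.replicate n (FSTree.triv P) := by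
  rw [single, ← List.replicate_succ, List.replicate_append_replicate]
  congr 1; omega

theorem comp_single {n i j : ℕ} (s u : FSTree P) (hj : j < s.leaves) :
    comp (single n i s) (single (i + (s.leaves + (n - (i + 1)))) (i + j) u)
      = single n i (s.graft (single s.leaves j u)) := by
  have e : single (i + (s.leaves + (n - (i + 1)))) (i + j) u
      = List.replicate i (FSTree.triv P) ++
        (single s.leaves j u ++ List.replicate (n - (i + 1)) (FSTree.triv P)) := by
    have : i + (s.leaves + (n - (i + 1))) - (i + j + 1)
        = (s.leaves - (j + 1)) + (n - (i + 1)) := by omega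
    simp only [single, this, List.append_assoc, List.cons_append,
      List.replicate_append_replicate]
    rw [← List.append_assoc, List.replicate_append_replicate]
  rw [e, single, comp_append]
  have h1 := triv_comp (List.replicate i (FSTree.triv P))
  have h2 := triv_comp (List.replicate (n - (i + 1)) (FSTree.triv P))
  have h3 : (List.replicate i (FSTree.triv P)).length = i := by simp
  have h4 := length_single hj u
  rw [List.length_replicate] at h1 h2
  rw [leaves_replicate_triv, List.take_left' h3, List.drop_left' h3, h1, comp,
    List.take_left' h4, List.drop_left' h4, h2]
  rfl

end Forest

/-! ## Pointed trees -/

/-- A pointed tree: a tree with a distinguished leaf. Leaves are numbered from `0`. -/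
@[ext] structure PointedTree {S : Type u} (P : SkeinPresentation S) where
  tree : FSTree P
  leaf : ℕ
  leaf_lt : leaf < tree.leaves

/-- The monoid of pointed trees: `(t, i) ∘ (s, j)` is obtained by gluing `s` to the `i`th leaf of
`t` and keeping the distinguished leaf of `s`. -/
noncomputable instance {S : Type u} (P : SkeinPresentation S) : Monoid (PointedTree P) where
  one := ⟨FSTree.triv P, 0, Nat.one_pos⟩
  mul a b := ⟨a.tree.graft (Forest.single a.tree.leaves a.leaf b.tree), a.leaf + b.leaf, by
    rw [Forest.leaves_graft _ _ (Forest.length_single a.leaf_lt _), Forest.leaves_single]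
    have := b.leaf_lt
    omega⟩
  one_mul a := PointedTree.ext (Forest.triv_graft _) (Nat.zero_add _)
  mul_one a := PointedTree.ext
    ((congrArg _ (Forest.single_triv a.leaf_lt)).trans (Forest.graft_triv _)) rfl
  mul_assoc a b c := by
    refine PointedTree.ext ?_ (Nat.add_assoc _ _ _)
    have h := Forest.length_single a.leaf_lt b.tree
    change (a.tree.graft (Forest.single _ _ b.tree)).graft
        (Forest.single (a.tree.graft (Forest.single _ _ b.tree)).leaves (a.leaf + b.leaf) c.tree)
      = a.tree.graft (Forest.single _ _ (b.tree.graft (Forest.single _ _ c.tree)))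
    rw [Forest.leaves_graft _ _ h, Forest.leaves_single, Forest.graft_graft _ _ _ h,
      Forest.comp_single _ _ b.leaf_lt]
    rw [Forest.length_single (by have := b.leaf_lt; omega), Forest.leaves_single]

/-- The two ends: `min` stands for `o` and first leaves, `max` for `ω` and last leaves. -/
inductive Extremity
  | min
  | max

/-- The submonoid of trees pointed at their first (resp. last) leaf. -/
def extremePointedTrees {S : Type u} (P : SkeinPresentation S) :
    Extremity → Submonoid (PointedTree P)
  | .min =>
    { carrier := {a | a.leaf = 0}
      one_mem' := rfl
      mul_mem' := fun {a b} ha hb => by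
        change a.leaf + b.leaf = 0
        rw [show a.leaf = 0 from ha, show b.leaf = 0 from hb] }
  | .max =>
    { carrier := {a | a.leaf + 1 = a.tree.leaves}
      one_mem' := rfl
      mul_mem' := fun {a b} ha hb => by
        have ha : a.leaf + 1 = a.tree.leaves := ha
        have hb : b.leaf + 1 = b.tree.leaves := hb
        change a.leaf + b.leaf + 1
          = (a.tree.graft (Forest.single a.tree.leaves a.leaf b.tree)).leaves
        rw [Forest.leaves_graft _ _ (Forest.length_single a.leaf_lt _), Forest.leaves_single]
        omega }

/-- The caret `Y_a` pointed at its first (resp. last) leaf. -/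
def pointedCaret {S : Type u} (P : SkeinPresentation S) (χ : Extremity) (a : S) :
    extremePointedTrees P χ :=
  match χ with
  | .min => ⟨⟨FSTree.mk P (.caret a .triv .triv), 0, Nat.two_pos⟩, rfl⟩
  | .max => ⟨⟨FSTree.mk P (.caret a .triv .triv), 1, Nat.one_lt_two⟩, rfl⟩

/-! ## The space of the canonical actions -/

section Space

variable {S : Type u} (P : SkeinPresentation S)

/-- The inverse limit of the leaf sets `Leaf(t)` over all trees `t`: for every tree `t` and every
forest `f` composable with `t`, the leaf of `t ∘ f` maps to the leaf of `t` lying below it. -/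
def LimitSpace : Type u :=
  {x : ∀ t : FSTree P, Fin t.leaves //
    ∀ (t : FSTree P) (f : List (FSTree P)), f.length = t.leaves →
      Forest.root f (x (t.graft f)) = (x t : ℕ)}

/-- The profinite topology. -/
instance : TopologicalSpace (LimitSpace P) := instTopologicalSpaceSubtype

/-- `x ≤ y` when `x(t) ≤ y(t)` eventually in `t`. -/
instance : LE (LimitSpace P) where
  le x y := ∃ t₀ : FSTree P, ∀ f : List (FSTree P), f.length = t₀.leaves →
    (x.1 (t₀.graft f) : ℕ) ≤ y.1 (t₀.graft f)

end Space

namespace LimitSpace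

open Forest

variable {S : Type u} {P : SkeinPresentation S}

theorem root_zero (f : List (FSTree P)) : root f 0 = 0 := by
  cases f with
  | nil => rfl
  | cons t f => simp [root, t.leaves_pos]

theorem root_last (f : List (FSTree P)) : root f (leaves f - 1) = f.length - 1 := by
  induction f using List.reverseRecOn with
  | nil => rfl
  | append_singleton f t _ =>
    have := t.leaves_pos
    rw [root_append, if_neg (by simp; omega)]
    have : leaves (f ++ [t]) - 1 - leaves f < t.leaves := by simp; omega
    simp only [root, if_pos this]
    simp

/-- The extremities: `o` takes the first leaf, `ω` the last leaf of every tree. -/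
def extremity (P : SkeinPresentation S) : Extremity → LimitSpace P
  | .min => ⟨fun t => ⟨0, t.leaves_pos⟩, fun t f _ => root_zero f⟩
  | .max => ⟨fun t => ⟨t.leaves - 1, Nat.sub_lt t.leaves_pos Nat.one_pos⟩, fun t f h => by
      change root f ((t.graft f).leaves - 1) = t.leaves - 1
      rw [leaves_graft _ _ h, root_last, h]⟩

theorem isBot_extremity_min : IsBot (extremity P .min) := fun _ =>
  ⟨FSTree.triv P, fun _ _ => Nat.zero_le _⟩

theorem isTop_extremity_max : IsTop (extremity P .max) := fun x =>
  ⟨FSTree.triv P, fun _ _ => Nat.le_sub_one_of_lt (x.1 _).2⟩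

section Ore

variable [OreCategory (FSCat P)]

theorem cancel (t : FSTree P) {p q : List (FSTree P)} (hp : p.length = t.leaves)
    (hq : q.length = t.leaves) (h : t.graft p = t.graft q) : p = q := by
  have hl : leaves q = leaves p := by rw [← leaves_graft t q hq, ← h, leaves_graft t p hp]
  let f : (⟨1⟩ : FSCat P) ⟶ ⟨t.leaves⟩ := FSCat.ofTree t rfl
  let p' : (⟨t.leaves⟩ : FSCat P) ⟶ ⟨leaves p⟩ := ⟨p, hp, rfl⟩
  let q' : (⟨t.leaves⟩ : FSCat P) ⟶ ⟨leaves p⟩ := ⟨q, hq, hl⟩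
  have e : f ≫ p' = f ≫ q' := by
    refine Subtype.ext ((FSCat.val_eq _).trans (Eq.trans ?_ (FSCat.val_eq _).symm))
    rw [FSCat.toTree_comp, FSCat.toTree_comp]
    exact congrArg (fun a => [a]) h
  exact congrArg Subtype.val (IsLeftCancellative.left_cancel f e)

theorem common_tree (t u : FSTree P) : ∃ p q : List (FSTree P), p.length = t.leaves ∧
    q.length = u.leaves ∧ t.graft p = u.graft q := by
  obtain ⟨d, p, q, h⟩ := OreCategory.common_right_multiple
    (FSCat.ofTree t rfl) (FSCat.ofTree u rfl)
  refine ⟨p.1, q.1, p.2.1, q.2.1, ?_⟩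
  have := congrArg FSCat.toTree h
  rwa [FSCat.toTree_comp, FSCat.toTree_comp] at this

theorem common_forest {f g : List (FSTree P)} (h : f.length = g.length) :
    ∃ p q : List (FSTree P), p.length = leaves f ∧ q.length = leaves g ∧ comp f p = comp g q := by
  obtain ⟨d, p, q, e⟩ := OreCategory.common_right_multiple
    (show (⟨f.length⟩ : FSCat P) ⟶ ⟨leaves f⟩ from ⟨f, rfl, rfl⟩)
    (show (⟨f.length⟩ : FSCat P) ⟶ ⟨leaves g⟩ from ⟨g, h.symm, rfl⟩)
  exact ⟨p.1, q.1, p.2.1, q.2.1, congrArg Subtype.val e⟩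

theorem ext_above {x y : LimitSpace P} (t : FSTree P)
    (h : ∀ p : List (FSTree P), p.length = t.leaves →
      (x.1 (t.graft p) : ℕ) = y.1 (t.graft p)) : x = y := by
  refine Subtype.ext (funext fun u => Fin.ext ?_)
  obtain ⟨p, q, hp, hq, e⟩ := common_tree t u
  rw [← x.2 u q hq, ← y.2 u q hq, ← e, h p hp]

/-- A point of the limit is determined by a coherent choice of leaves of the trees above `t`. -/
theorem exists_extend (t : FSTree P) (v : List (FSTree P) → ℕ)
    (hv : ∀ p, p.length = t.leaves → v p < leaves p)
    (hc : ∀ p a, p.length = t.leaves → a.length = leaves p → root a (v (comp p a)) = v p) :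
    ∃ x : LimitSpace P, ∀ p, p.length = t.leaves → (x.1 (t.graft p) : ℕ) = v p := by
  choose p q hp hq e using common_tree t
  have hlt : ∀ u, root (q u) (v (p u)) < u.leaves := fun u => by
    rw [← hq u]
    refine root_lt _ _ ?_
    rw [← leaves_graft _ _ (hq u), ← e, leaves_graft _ _ (hp u)]
    exact hv _ (hp u)
  have key : ∀ (u : FSTree P) (p' q' : List (FSTree P)), p'.length = t.leaves →
      q'.length = u.leaves → t.graft p' = u.graft q' → root (q u) (v (p u)) = root q' (v p') := by
    intro u p' q' hp' hq' e'
    obtain ⟨a, b, ha, hb, hab⟩ := common_forest (f := p u) (g := p') (by rw [hp, hp'])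
    have l1 : leaves (p u) = leaves (q u) := by
      rw [← leaves_graft _ _ (hp u), e, leaves_graft _ _ (hq u)]
    have l2 : leaves p' = leaves q' := by
      rw [← leaves_graft _ _ hp', e', leaves_graft _ _ hq']
    have e2 : comp (q u) a = comp q' b := by
      refine cancel u (by simp [hq]) (by simp [hq']) ?_
      rw [← graft_graft _ _ _ (hq u) (by omega), ← graft_graft _ _ _ hq' (by omega), ← e, ← e',
        graft_graft _ _ _ (hp u) ha, graft_graft _ _ _ hp' hb, hab]
    have b1 : v (comp (p u) a) < leaves a := by
      have := hv (comp (p u) a) (by simp [hp])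
      rwa [leaves_comp _ _ ha] at this
    have b2 : v (comp p' b) < leaves b := by
      have := hv (comp p' b) (by simp [hp'])
      rwa [leaves_comp _ _ hb] at this
    rw [← hc _ a (hp u) ha, ← hc p' b hp' hb, root_comp _ _ _ (by omega) b1,
      root_comp _ _ _ (by omega) b2, e2, hab]
  refine ⟨⟨fun u => ⟨root (q u) (v (p u)), hlt u⟩, fun u f hf => ?_⟩, fun p' hp' => ?_⟩
  · have h1 : (q (u.graft f)).length = leaves f := by rw [hq, leaves_graft _ _ hf]
    have h2 : v (p (u.graft f)) < leaves (q (u.graft f)) := by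
      rw [← leaves_graft _ _ (hq _), ← e, leaves_graft _ _ (hp _)]
      exact hv _ (hp _)
    change root f (root (q (u.graft f)) (v (p (u.graft f)))) = root (q u) (v (p u))
    rw [root_comp _ _ _ h1 h2]
    refine (key u _ _ (hp _) (by simp [hf]) ?_).symm
    rw [e, graft_graft _ _ _ hf h1]
  · change root (q (t.graft p')) (v (p (t.graft p'))) = v p'
    rw [key (t.graft p') p' (List.replicate (t.graft p').leaves (FSTree.triv P)) hp' (by simp)
      (graft_triv _).symm]
    refine root_triv _ _ ?_
    rw [leaves_graft _ _ hp']
    exact hv _ hp'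

/-! ### The canonical monoid action -/

theorem exists_beta (a : PointedTree P) (w : LimitSpace P) : ∃ x : LimitSpace P,
    ∀ p, p.length = a.tree.leaves →
      (x.1 (a.tree.graft p) : ℕ) = offset p a.leaf + w.1 (tree p a.leaf) := by
  refine exists_extend a.tree (fun p => offset p a.leaf + w.1 (tree p a.leaf)) ?_ ?_
  · intro p hp
    exact offset_add_lt _ _ _ (by rw [hp]; exact a.leaf_lt) (w.1 _).2
  · intro p b hp hb
    have hi : a.leaf < p.length := by rw [hp]; exact a.leaf_lt
    have h1 := offset_add_lt p a.leaf ((tree p a.leaf).leaves - 1) hi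
      (Nat.sub_lt (FSTree.leaves_pos _) Nat.one_pos)
    have h2 := (tree p a.leaf).leaves_pos
    have hl : ((b.drop (offset p a.leaf)).take (tree p a.leaf).leaves).length
        = (tree p a.leaf).leaves := by
      rw [List.length_take, List.length_drop]; omega
    change root b (offset (comp p b) a.leaf + w.1 (tree (comp p b) a.leaf)) = _
    rw [offset_comp _ _ _ hi.le hb, root_offset_add _ _ _ (by omega), tree_comp _ _ _ hi]
    rw [root_take _ (tree p a.leaf).leaves, w.2 _ _ hl]
    exact lt_of_lt_of_eq (w.1 ((tree p a.leaf).graft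
      ((b.drop (offset p a.leaf)).take (tree p a.leaf).leaves))).2 (leaves_graft _ _ hl)

/-- The transformation `w ↦ (t, i) · w`: prefixing the point `w` by the pointed tree `(t, i)`.
It is characterised by `betaFun_apply`. -/
noncomputable def betaFun (a : PointedTree P) (w : LimitSpace P) : LimitSpace P :=
  (exists_beta a w).choose

/-- `β(t, i)(w)` takes on `t ∘ p` the leaf of the `i`th tree `p_i` of `p` that `w` takes on
`p_i`. -/
theorem betaFun_apply (a : PointedTree P) (w : LimitSpace P) (p : List (FSTree P))
    (hp : p.length = a.tree.leaves) : ((betaFun a w).1 (a.tree.graft p) : ℕ)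
      = offset p a.leaf + w.1 (tree p a.leaf) :=
  (exists_beta a w).choose_spec p hp

instance : PartialOrder (LimitSpace P) where
  le_refl x := ⟨FSTree.triv P, fun _ _ => le_rfl⟩
  le_trans x y z := by
    rintro ⟨t, ht⟩ ⟨u, hu⟩
    obtain ⟨p, q, hp, hq, e⟩ := common_tree t u
    refine ⟨t.graft p, fun f hf => ?_⟩
    have hf' : f.length = leaves q := by rw [hf, e, leaves_graft _ _ hq]
    rw [leaves_graft _ _ hp] at hf
    have h1 := ht (comp p f) (by rw [length_comp, hp])
    have h2 := hu (comp q f) (by rw [length_comp, hq])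
    rw [← graft_graft _ _ _ hp hf] at h1
    rw [← graft_graft _ _ _ hq hf', ← e] at h2
    exact h1.trans h2
  le_antisymm x y := by
    rintro ⟨t, ht⟩ ⟨u, hu⟩
    obtain ⟨p, q, hp, hq, e⟩ := common_tree t u
    refine ext_above (t.graft p) fun f hf => ?_
    have hf' : f.length = leaves q := by rw [hf, e, leaves_graft _ _ hq]
    rw [leaves_graft _ _ hp] at hf
    have h1 := ht (comp p f) (by rw [length_comp, hp])
    have h2 := hu (comp q f) (by rw [length_comp, hq])
    rw [← graft_graft _ _ _ hp hf] at h1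
    rw [← graft_graft _ _ _ hq hf', ← e] at h2
    exact le_antisymm h1 h2

/-- The canonical monoid action `β` of the pointed trees. -/
noncomputable def beta : PointedTree P →* Function.End (LimitSpace P) where
  toFun := betaFun
  map_one' := by
    refine funext fun w => ext_above (FSTree.triv P) fun p hp => ?_
    have h := betaFun_apply (1 : PointedTree P) w p hp
    match p, hp with
    | [t], _ =>
      refine h.trans ?_
      change 0 + (w.1 t : ℕ) = w.1 ((FSTree.triv P).graft [t])
      rw [triv_graft, Nat.zero_add]
  map_mul' a b := by
    refine funext fun w => ext_above (a * b).tree fun p hp => ?_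
    have hF := length_single a.leaf_lt b.tree
    have hb := b.leaf_lt
    have hp' : p.length = a.leaf + (b.tree.leaves + (a.tree.leaves - (a.leaf + 1))) := by
      rw [hp, ← leaves_single]; exact leaves_graft _ _ hF
    have hi : a.leaf < (single a.tree.leaves a.leaf b.tree).length := by rw [hF]; exact a.leaf_lt
    have hl : ((p.drop a.leaf).take b.tree.leaves).length = b.tree.leaves := by
      rw [List.length_take, List.length_drop]; omega
    rw [betaFun_apply _ _ _ hp]
    change offset p (a.leaf + b.leaf) + (w.1 (tree p (a.leaf + b.leaf)) : ℕ)
      = (betaFun a (betaFun b w)).1 ((a.tree.graft (single a.tree.leaves a.leaf b.tree)).graft p)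
    have e : tree ((p.drop a.leaf).take b.tree.leaves) b.leaf = tree p (a.leaf + b.leaf) := by
      rw [tree, tree, List.getD_eq_getElem _ _ (by omega), List.getD_eq_getElem _ _ (by omega)]
      simp
    rw [graft_graft _ _ _ hF (by rw [leaves_single, hp']),
      betaFun_apply _ _ _ (by rw [length_comp, hF]), tree_comp _ _ _ hi,
      offset_comp _ _ _ hi.le (by rw [leaves_single, hp']), tree_single, offset_single,
      betaFun_apply _ _ _ hl, e, offset_add, Nat.add_assoc]
    congr 2
    rw [offset, offset, List.take_take, min_eq_left hb.le]

/-- The monoid `β(𝒯_o)` (resp. `β(𝒯_ω)`) of transformations of the space. -/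
noncomputable def betaMonoid (P : SkeinPresentation S) [OreCategory (FSCat P)] (χ : Extremity) :
    Submonoid (Function.End (LimitSpace P)) :=
  (extremePointedTrees P χ).map beta

/-- The transformation `β(Y_a, 𝟶)` (resp. `β(Y_a, 𝟷)`). -/
noncomputable def betaCaret (P : SkeinPresentation S) [OreCategory (FSCat P)] (χ : Extremity)
    (a : S) : betaMonoid P χ :=
  ⟨beta (pointedCaret P χ a).1, Submonoid.mem_map_of_mem _ (pointedCaret P χ a).2⟩

/-! ### The canonical group action -/

theorem exists_alpha (t s : FSTree P) (h : t.leaves = s.leaves) (x : LimitSpace P) :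
    ∃ y : LimitSpace P, ∀ p, p.length = t.leaves →
      (y.1 (t.graft p) : ℕ) = x.1 (s.graft p) := by
  refine exists_extend t (fun p => x.1 (s.graft p)) ?_ ?_
  · intro p hp
    exact lt_of_lt_of_eq (x.1 _).2 (leaves_graft _ _ (hp.trans h))
  · intro p a hp ha
    have := x.2 (s.graft p) a (by rw [leaves_graft _ _ (hp.trans h), ha])
    rwa [graft_graft _ _ _ (hp.trans h) ha] at this

/-- The action of a pair of trees with the same number of leaves:
`([t, s] · x)(t ∘ p) = x(s ∘ p)` for every forest `p`. -/
noncomputable def alphaFun (t s : FSTree P) (h : t.leaves = s.leaves) (x : LimitSpace P) :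
    LimitSpace P :=
  (exists_alpha t s h x).choose

theorem alphaFun_apply (t s : FSTree P) (h : t.leaves = s.leaves) (x : LimitSpace P)
    (p : List (FSTree P)) (hp : p.length = t.leaves) :
    ((alphaFun t s h x).1 (t.graft p) : ℕ) = x.1 (s.graft p) :=
  (exists_alpha t s h x).choose_spec p hp

theorem alphaFun_self (t : FSTree P) (x : LimitSpace P) : alphaFun t t rfl x = x :=
  ext_above t fun p hp => alphaFun_apply _ _ _ _ p hp

theorem alphaFun_alphaFun (t s r : FSTree P) (h : t.leaves = s.leaves) (h' : s.leaves = r.leaves)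
    (x : LimitSpace P) :
    alphaFun t s h (alphaFun s r h' x) = alphaFun t r (h.trans h') x :=
  ext_above t fun p hp => by
    rw [alphaFun_apply _ _ _ _ p hp, alphaFun_apply _ _ _ _ p (hp.trans h),
      alphaFun_apply _ _ _ _ p hp]

theorem alphaFun_graft (t s : FSTree P) (h : t.leaves = s.leaves) (f : List (FSTree P))
    (hf : f.length = t.leaves) (h' : (t.graft f).leaves = (s.graft f).leaves) (x : LimitSpace P) :
    alphaFun (t.graft f) (s.graft f) h' x = alphaFun t s h x :=
  ext_above (t.graft f) fun p hp => by
    rw [alphaFun_apply _ _ _ _ p hp]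
    rw [leaves_graft _ _ hf] at hp
    rw [graft_graft _ _ _ hf hp, graft_graft _ _ _ (hf.trans h) hp,
      alphaFun_apply _ _ _ _ _ (by rw [length_comp, hf])]

theorem continuous_alphaFun (t s : FSTree P) (h : t.leaves = s.leaves) :
    Continuous (alphaFun t s h) := by
  refine Continuous.subtype_mk (f := fun x => (alphaFun t s h x).1) (continuous_pi fun u => ?_) _
  obtain ⟨p, q, hp, hq, e⟩ := common_tree t u
  have hlt : ∀ x : LimitSpace P, root q (x.1 (s.graft p)) < u.leaves := fun x => by
    rw [← hq]
    refine root_lt _ _ (lt_of_lt_of_eq (x.1 _).2 ?_)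
    rw [leaves_graft _ _ (hp.trans h), ← leaves_graft _ _ hp, e, leaves_graft _ _ hq]
  have h1 : (fun x => (alphaFun t s h x).1 u) = fun x => ⟨root q (x.1 (s.graft p)), hlt x⟩ := by
    funext x
    refine Fin.ext ?_
    rw [← (alphaFun t s h x).2 u q hq, ← e, alphaFun_apply _ _ _ _ _ hp]
  rw [h1]
  have h2 : Continuous fun x : LimitSpace P => x.1 (s.graft p) :=
    (continuous_apply (s.graft p)).comp continuous_subtype_val
  have h3 : IsLocallyConstant fun x : LimitSpace P =>
      (⟨root q (x.1 (s.graft p)), hlt x⟩ : Fin u.leaves) := by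
    rw [IsLocallyConstant.iff_eventually_eq]
    intro x
    have : ∀ᶠ y in nhds x, y.1 (s.graft p) = x.1 (s.graft p) :=
      (h2.tendsto x).eventually ((isOpen_discrete {x.1 (s.graft p)}).mem_nhds rfl)
    filter_upwards [this] with y hy
    exact Fin.ext (congrArg (fun a : Fin (s.graft p).leaves => root q a) hy)
  exact h3.continuous

/-- The homeomorphism given by a pair of trees. -/
noncomputable def alphaHomeo (t s : FSTree P) (h : t.leaves = s.leaves) :
    LimitSpace P ≃ₜ LimitSpace P where
  toFun := alphaFun t s h
  invFun := alphaFun s t h.symm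
  left_inv x := by rw [alphaFun_alphaFun, alphaFun_self]
  right_inv x := by rw [alphaFun_alphaFun, alphaFun_self]
  continuous_toFun := continuous_alphaFun _ _ _
  continuous_invFun := continuous_alphaFun _ _ _

end Ore

end LimitSpace

/-! ## The forest-skein groups and their canonical actions -/

section Groups

variable {S : Type u} (P : SkeinPresentation S) [OreCategory (FSCat P)]

/-- The (`F`-type) forest-skein group `G = Frac(𝓕, 1)`. -/
abbrev FSGroup : Type u := FracGroup (FSCat P) ⟨1⟩

variable {P}

theorem alphaHomeo_comp {n m : ℕ} (t s : (⟨1⟩ : FSCat P) ⟶ ⟨n⟩) (f : (⟨n⟩ : FSCat P) ⟶ ⟨m⟩) :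
    LimitSpace.alphaHomeo (FSCat.toTree (t ≫ f)) (FSCat.toTree (s ≫ f))
        (FSCat.leaves_toTree_eq _ _)
      = LimitSpace.alphaHomeo (FSCat.toTree t) (FSCat.toTree s)
        (FSCat.leaves_toTree_eq _ _) := by
  refine Homeomorph.ext fun x => ?_
  change LimitSpace.alphaFun _ _ (FSCat.leaves_toTree_eq _ _) x
    = LimitSpace.alphaFun _ _ (FSCat.leaves_toTree_eq _ _) x
  simp only [FSCat.toTree_comp]
  exact LimitSpace.alphaFun_graft _ _ _ _ (by rw [FSCat.leaves_toTree, f.2.1]) _ _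

variable (P)

/-- The canonical action `α` of the forest-skein group by homeomorphisms. -/
noncomputable def canonicalAction : FSGroup P →* (LimitSpace P ≃ₜ LimitSpace P) where
  toFun := Quotient.lift (s := fracSetoid (⟨1⟩ : FSCat P))
    (fun a => LimitSpace.alphaHomeo (FSCat.toTree a.num) (FSCat.toTree a.den)
      (FSCat.leaves_toTree_eq _ _))
    (by
      rintro a b ⟨z, p, q, h1, h2⟩
      have e1 := alphaHomeo_comp a.num a.den p
      have e2 := alphaHomeo_comp b.num b.den q
      simp only [h1, h2] at e1
      exact e1.symm.trans e2)
  map_one' := Homeomorph.ext fun x => LimitSpace.alphaFun_self _ x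
  map_mul' a b := by
    induction a using FracGroup.ind with | _ x f g
    induction b using FracGroup.ind with | _ y h k
    obtain ⟨z, p, q, e⟩ := OreCategory.common_right_multiple g h
    rw [FracGroup.mk_mul_mk e, ← FracGroup.mk_expand f g p, ← FracGroup.mk_expand h k q, e]
    refine Homeomorph.ext fun x => ?_
    exact (LimitSpace.alphaFun_alphaFun (FSCat.toTree (f ≫ p)) (FSCat.toTree (h ≫ q))
      (FSCat.toTree (k ≫ q)) (FSCat.leaves_toTree_eq _ _) (FSCat.leaves_toTree_eq _ _) x).symm

/-- A permutation of `n` letters is cyclic if it is a power of the rotation. -/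
def IsCyclicPerm {n : ℕ} (π : Equiv.Perm (Fin n)) : Prop := ∃ k : ℕ, π = finRotate n ^ k

/-- `φ` is the canonical transformation given by `[t, π, s]`, where `t`, `s` are trees with `n`
leaves and `π` is a permutation of their leaves: `φ ((s, j) · w) = (t, π(j)) · w`. -/
def IsCanonicalTransformation (φ : LimitSpace P ≃ₜ LimitSpace P) {n : ℕ} (t s : FSTree P)
    (ht : t.leaves = n) (hs : s.leaves = n) (π : Equiv.Perm (Fin n)) : Prop :=
  ∀ (j : Fin n) (w : LimitSpace P),
    φ (LimitSpace.beta ⟨s, j, lt_of_lt_of_eq j.2 hs.symm⟩ w)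
      = LimitSpace.beta ⟨t, π j, lt_of_lt_of_eq (π j).2 ht.symm⟩ w

/-- The group of homeomorphisms through which the `T`-type forest-skein group acts canonically, that
is, the group of the transformations `[t, π, s]` with `π` cyclic. (These transformations are closed
under products and inverses, so that taking the generated subgroup adds nothing.) -/
def canonicalGroupT : Subgroup (LimitSpace P ≃ₜ LimitSpace P) :=
  Subgroup.closure {φ | ∃ (n : ℕ) (t s : FSTree P) (ht : t.leaves = n) (hs : s.leaves = n)
    (π : Equiv.Perm (Fin n)), IsCyclicPerm π ∧ IsCanonicalTransformation P φ t s ht hs π}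

/-- The group of homeomorphisms through which the `V`-type forest-skein group acts canonically, that
is, the group of the transformations `[t, π, s]` with `π` any permutation. (These transformations
are closed under products and inverses, so that taking the generated subgroup adds nothing.) -/
def canonicalGroupV : Subgroup (LimitSpace P ≃ₜ LimitSpace P) :=
  Subgroup.closure {φ | ∃ (n : ℕ) (t s : FSTree P) (ht : t.leaves = n) (hs : s.leaves = n)
    (π : Equiv.Perm (Fin n)), IsCanonicalTransformation P φ t s ht hs π}

end Groups

/-! ## Colour words and the presented group -/

/-- The word of colours read from the root to the first (resp. last) leaf of a free tree. -/
def FreeTree.prune {S : Type u} (χ : Extremity) : FreeTree S → List S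
  | .triv => []
  | .caret a l r => a :: (match χ with
    | .min => l.prune χ
    | .max => r.prune χ)

/-- The group with generators the colours and one relation `prune t = prune s` for each skein
relation `(t, s)`. -/
abbrev PruneGroup {S : Type u} (P : SkeinPresentation S) (χ : Extremity) : Type u :=
  PresentedGroup {r : FreeGroup S | ∃ t s : FreeTree S, P.rel t s ∧
    r = ((t.prune χ).map FreeGroup.of).prod * (((s.prune χ).map FreeGroup.of).prod)⁻¹}

/-- The element of the presented group given by the word read in a free tree. -/
def pruneElt {S : Type u} (P : SkeinPresentation S) (χ : Extremity) (t : FreeTree S) :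
    PruneGroup P χ :=
  ((t.prune χ).map PresentedGroup.of).prod

/-! Everything is read off from cones. A pointed tree `(t, i)` embeds the space into itself, with
image the clopen set of points whose value at `t` is `i` (`betaFun_injective`, `exists_betaFun_eq`).
Grafting composes these embeddings (`betaFun_graft`), and the cones at extreme leaves form a
neighbourhood basis of the end `χ`. Injectivity gives left cancellation in `β(𝒯_χ)`; a common
refinement `t ∘ p = s ∘ q`, read at the extreme leaf, gives common right multiples.

What is grafted away from the end does not affect the cone at the end, so `β(t, χ)` is the product
of the `β(Y_a, χ)` along the word of `t` (`extremeBeta_mk`). Hence `κ` is well defined and onto.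
Only its injectivity needs simplicity. Call two trees equivalent when they have equally many leaves
and corresponding leaves give the same embedding. This is a congruence (`SameCones.graft`) with
left-cancellative quotient (`SameCones.of_graft`), so simplicity forces it to be equality
(`eq_of_sameCones`). If `β(t, χ) = β(s, χ)` and `t ∘ p = s ∘ q`, the trees of `p` and `q` over the
distinguished leaves occupy the same leaves of the common tree and have the same cones, so they are
equal; cancelling their word in `Γ_χ` shows that `t` and `s` have the same word there
(`pruneClass_eq_of_betaFun_eq`).

The element `[t, s]` sends `β(s, χ)(w)` to `β(t, χ)(w)`. So it fixes `χ`, and its germ there is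
trivial iff `β(t, χ) x = β(s, χ) x` for some `x` in `β(𝒯_χ)`, that is, iff the two become equal in
the fraction group (`kappaHom_pruneHom_eq_one_iff`).

An element of `G^V` locally replaces one cone by another; if it fixes `χ`, padding both trees to the
same number of leaves exhibits its germ as that of an element of `G`. Conversely, every germ of `G`
at `χ` is that of some `f` in `G` which is trivial near the other end (`exists_refinements`). If `h`
in `G^T` carries a cone at `χ` to one at the other end, the commutator `f h⁻¹ f⁻¹ h` has the germ of
`f` at `χ`. So all groups between `[G^T, G^T]` and `G^V` have the same germs at `χ`. -/

namespace Extremity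

/-- The position of the first (resp. last) of `n` leaves. -/
def idx : Extremity → ℕ → ℕ
  | .min, _ => 0
  | .max, n => n - 1

/-- The other end. -/
def opp : Extremity → Extremity
  | .min => .max
  | .max => .min

theorem idx_lt (χ : Extremity) {n : ℕ} (h : 0 < n) : χ.idx n < n := by
  cases χ <;> simp only [idx] <;> omega

@[simp] theorem idx_one (χ : Extremity) : χ.idx 1 = 0 := by cases χ <;> rfl

theorem idx_ne_idx_opp (χ : Extremity) {n : ℕ} (h : 2 ≤ n) : χ.idx n ≠ χ.opp.idx n := by
  cases χ <;> simp only [idx, opp] <;> omega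

end Extremity

/-! ### Positions of leaves in forests and in single grafts. -/

namespace Forest

variable {S : Type u} {P : SkeinPresentation S}

/-- Makes extreme pointings compatible with grafting: the extreme leaf of a forest is the extreme
leaf of its extreme tree. -/
theorem idx_leaves (χ : Extremity) (f : List (FSTree P)) (h : 0 < f.length) :
    χ.idx (leaves f) = offset f (χ.idx f.length)
      + χ.idx (tree f (χ.idx f.length)).leaves := by
  cases χ with
  | min => rfl
  | max =>
    have h1 := offset_succ f (f.length - 1) (by omega)
    have h2 := (tree f (f.length - 1)).leaves_pos
    rw [show f.length - 1 + 1 = f.length by omega, offset, List.take_length] at h1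
    simp only [Extremity.idx]
    omega

theorem tree_replicate_triv (n i : ℕ) :
    tree (List.replicate n (FSTree.triv P)) i = FSTree.triv P := by
  rw [tree, List.getD_eq_getElem?_getD, List.getElem?_replicate]
  split_ifs <;> rfl

theorem offset_replicate_triv {n i : ℕ} (h : i ≤ n) :
    offset (List.replicate n (FSTree.triv P)) i = i := by
  rw [offset, List.take_replicate, leaves_replicate_triv, min_eq_left h]

theorem tree_single_of_ne {n i j : ℕ} (s : FSTree P) (h : j ≠ i) :
    tree (single n i s) j = FSTree.triv P := by
  rcases Nat.lt_or_gt_of_ne h with h | h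
  · rw [tree, single, List.getD_append _ _ _ _ (by simpa using h)]
    exact tree_replicate_triv i j
  · rw [tree, single, List.getD_append_right _ _ _ _ (by simpa using h.le),
      List.length_replicate, show j - i = (j - i - 1) + 1 by omega, List.getD_cons_succ]
    exact tree_replicate_triv _ _

theorem tree_take_drop (p : List (FSTree P)) (k : ℕ) {j m : ℕ} (h : j < m) :
    tree ((p.drop k).take m) j = tree p (k + j) := by
  simp only [tree, List.getD_eq_getElem?_getD, List.getElem?_take_of_lt h, List.getElem?_drop]

theorem offset_take (p : List (FSTree P)) {j m : ℕ} (h : j ≤ m) :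
    offset (p.take m) j = offset p j := by
  rw [offset, offset, List.take_take, min_eq_left h]

/-- The leaves lying above the root with index `i`. -/
theorem exists_offset_add (f : List (FSTree P)) (k : ℕ) (hk : k < leaves f) :
    ∃ m < (tree f (root f k)).leaves, k = offset f (root f k) + m := by
  induction f generalizing k with
  | nil => simp at hk
  | cons t f ih =>
    simp only [leaves_cons] at hk
    by_cases h : k < t.leaves
    · refine ⟨k, ?_, ?_⟩ <;> simp [root, h, tree, offset]
    · obtain ⟨m, hm, e⟩ := ih (k - t.leaves) (by omega)
      refine ⟨m, ?_, ?_⟩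
      · simpa [root, h, tree] using hm
      · simp only [root, if_neg h, offset, List.take_succ_cons, leaves_cons] at e ⊢
        omega

theorem comp_single_append (n i : ℕ) (u : FSTree P) (f : List (FSTree P))
    (hf : f.length = u.leaves) :
    comp (single n i u) (List.replicate i (FSTree.triv P) ++
      (f ++ List.replicate (n - (i + 1)) (FSTree.triv P))) = single n i (u.graft f) := by
  have h1 := triv_comp (List.replicate i (FSTree.triv P))
  have h2 := triv_comp (List.replicate (n - (i + 1)) (FSTree.triv P))
  have h3 : (List.replicate i (FSTree.triv P)).length = i := by simp
  rw [List.length_replicate] at h1 h2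
  rw [single, comp_append, leaves_replicate_triv, List.take_left' h3, List.drop_left' h3, h1, comp,
    List.take_left' hf, List.drop_left' hf, h2]
  rfl

/-- Any forest can be grown by first growing its `i`th tree and then the others. So the values of a
point over leaf `i` of a tree are controlled by single grafts at that leaf. -/
theorem comp_single_expand (p : List (FSTree P)) (i : ℕ) (hi : i < p.length) :
    comp (single p.length i (tree p i)) (p.take i ++
      (List.replicate (tree p i).leaves (FSTree.triv P) ++ p.drop (i + 1))) = p := by
  have h1 := triv_comp (p.take i)
  have h2 := triv_comp (p.drop (i + 1))
  have h3 : (p.take i).length = i := by rw [List.length_take]; omega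
  have h4 : (List.replicate (tree p i).leaves (FSTree.triv P)).length = (tree p i).leaves := by simp
  rw [h3] at h1
  rw [List.length_drop] at h2
  rw [single, comp_append, leaves_replicate_triv, List.take_left' h3, List.drop_left' h3, h1, comp,
    List.take_left' h4, List.drop_left' h4, h2, graft_triv, ← drop_eq_cons _ _ hi,
    List.take_append_drop]

end Forest

/-- A tree pointed at its first (resp. last) leaf. -/
@[simps] def PointedTree.extreme {S : Type u} {P : SkeinPresentation S} (χ : Extremity)
    (t : FSTree P) : PointedTree P :=
  ⟨t, χ.idx t.leaves, χ.idx_lt t.leaves_pos⟩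

theorem mem_extremePointedTrees {S : Type u} {P : SkeinPresentation S} {χ : Extremity}
    {a : PointedTree P} : a ∈ extremePointedTrees P χ ↔ a.leaf = χ.idx a.tree.leaves := by
  have := a.leaf_lt
  cases χ with
  | min => rfl
  | max =>
    change a.leaf + 1 = a.tree.leaves ↔ a.leaf = a.tree.leaves - 1
    omega

theorem eq_extreme {S : Type u} {P : SkeinPresentation S} {χ : Extremity} {a : PointedTree P}
    (h : a.leaf = χ.idx a.tree.leaves) : a = PointedTree.extreme χ a.tree :=
  PointedTree.ext rfl h

/-! ### Cones and the topology of the limit space. -/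

namespace LimitSpace

open Forest

variable {S : Type u} {P : SkeinPresentation S}

theorem extremity_apply (χ : Extremity) (t : FSTree P) :
    ((extremity P χ).1 t : ℕ) = χ.idx t.leaves := by
  cases χ <;> rfl

theorem eventually_apply_eq (t : FSTree P) (x : LimitSpace P) :
    ∀ᶠ y in nhds x, y.1 t = x.1 t := by
  have h : Continuous fun y : LimitSpace P => y.1 t :=
    (continuous_apply t).comp continuous_subtype_val
  exact (h.tendsto x).eventually ((isOpen_discrete {x.1 t}).mem_nhds rfl)

section Ore

variable [OreCategory (FSCat P)]

theorem betaFun_mk_apply (t : FSTree P) (i : ℕ) (hi : i < t.leaves) (w : LimitSpace P)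
    (p : List (FSTree P)) (hp : p.length = t.leaves) :
    ((betaFun ⟨t, i, hi⟩ w).1 (t.graft p) : ℕ) = offset p i + w.1 (tree p i) :=
  betaFun_apply ⟨t, i, hi⟩ w p hp

theorem betaFun_apply_tree (a : PointedTree P) (w : LimitSpace P) :
    ((betaFun a w).1 a.tree : ℕ) = a.leaf := by
  have h := betaFun_apply a w (List.replicate a.tree.leaves (FSTree.triv P)) (by simp)
  have h1 : (w.1 (FSTree.triv P) : ℕ) < 1 := (w.1 (FSTree.triv P)).2
  rw [graft_triv, tree_replicate_triv, offset_replicate_triv a.leaf_lt.le] at h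
  omega

/-- Grafting `u` at the distinguished leaf and nothing elsewhere shifts the leaves of `u` by
`a.leaf`, so the value `w(u)` can be recovered from the image of `w`. -/
theorem betaFun_injective (a : PointedTree P) : Function.Injective (betaFun a) := by
  intro w w' e
  refine Subtype.ext (funext fun u => Fin.ext ?_)
  have h := betaFun_apply a w _ (length_single a.leaf_lt u)
  have h' := betaFun_apply a w' _ (length_single a.leaf_lt u)
  rw [e, h', tree_single] at h
  omega

/-- The preimage is read on single grafts: if `u` is grafted at leaf `i` only, `x` must choose a
leaf of that copy of `u`, and its position in `u` is the value at `u`. -/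
theorem exists_betaFun_eq (a : PointedTree P) (x : LimitSpace P)
    (hx : (x.1 a.tree : ℕ) = a.leaf) : ∃ w, betaFun a w = x := by
  obtain ⟨t, i, hi⟩ := a
  simp only at hx
  have hs : ∀ u : FSTree P, ∃ m, m < u.leaves ∧
      (x.1 (t.graft (single t.leaves i u)) : ℕ) = i + m := by
    intro u
    have h1 := x.2 t _ (length_single hi u)
    have h2 := (x.1 (t.graft (single t.leaves i u))).2
    have h3 : leaves (single t.leaves i u) = (t.graft (single t.leaves i u)).leaves :=
      (leaves_graft _ _ (length_single hi u)).symm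
    obtain ⟨m, hm, e⟩ := exists_offset_add (single t.leaves i u) _ (lt_of_lt_of_eq h2 h3.symm)
    rw [h1, hx, tree_single] at hm
    rw [h1, hx, offset_single] at e
    exact ⟨m, hm, e⟩
  choose m hm e using hs
  refine ⟨⟨fun u => ⟨m u, hm u⟩, fun u f hf => ?_⟩, ?_⟩
  · change root f (m (u.graft f)) = m u
    have hl : leaves (single t.leaves i u) = i + (u.leaves + (t.leaves - (i + 1))) :=
      leaves_single _ _ _
    -- Coherence: refining the copy of `u` by `f` and leaving the other leaves alone turns the
    -- single graft of `u` into that of `u ∘ f`.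
    have h1 := x.2 (t.graft (single t.leaves i u)) (List.replicate i (FSTree.triv P) ++
      (f ++ List.replicate (t.leaves - (i + 1)) (FSTree.triv P))) (by
        rw [leaves_graft _ _ (length_single hi u), hl]; simp [hf])
    rw [graft_graft _ _ _ (length_single hi u) (by rw [hl]; simp [hf]),
      comp_single_append _ _ _ _ hf, e, e, root_append, if_neg (by simp), root_append,
      if_pos] at h1
    · simpa using h1
    · have := hm (u.graft f)
      rw [leaves_graft _ _ hf] at this
      simpa using this
  · refine ext_above t fun p hp => ?_
    refine (betaFun_mk_apply _ _ _ _ p hp).trans ?_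
    change offset p i + m (tree p i) = _
    have hip : i < p.length := by rw [hp]; exact hi
    obtain ⟨k, hk, ek⟩ := exists_offset_add p (x.1 (t.graft p))
      (lt_of_lt_of_eq (x.1 _).2 (leaves_graft _ _ hp))
    rw [x.2 t p hp, hx] at hk ek
    rw [ek]
    have h0 := length_single hi (tree p i)
    have hF : (p.take i ++ (List.replicate (tree p i).leaves (FSTree.triv P) ++
        p.drop (i + 1))).length = leaves (single t.leaves i (tree p i)) := by
      rw [leaves_single]; simp; omega
    have h1 := x.2 (t.graft (single t.leaves i (tree p i))) _
      (hF.trans (leaves_graft _ _ h0).symm)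
    rw [graft_graft _ _ _ h0 hF] at h1
    have h2 := comp_single_expand p i hip
    rw [hp] at h2
    -- The second stage of growth fixes the copy of the `i`th tree, so leaf `offset p i + k` lies
    -- over leaf `i + k` of the single graft, whence `m (tree p i) = k`.
    rw [h2, e, ek, root_append, if_neg (by simp [offset]), root_append, if_pos (by
      simp [offset]; omega), root_triv _ _ (by simp [offset]; omega)] at h1
    simp [offset] at h1 ⊢
    omega

/-- Extends the multiplicativity of `beta` from single grafts to all forests: the trees of `f` with
index other than `i` shift positions but do not change the cone. -/
theorem betaFun_graft (t : FSTree P) (f : List (FSTree P)) (hf : f.length = t.leaves)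
    (i j : ℕ) (hi : i < t.leaves) (hj : j < (tree f i).leaves)
    (h : offset f i + j < (t.graft f).leaves) (w : LimitSpace P) :
    betaFun ⟨t.graft f, offset f i + j, h⟩ w
      = betaFun ⟨t, i, hi⟩ (betaFun ⟨tree f i, j, hj⟩ w) := by
  refine ext_above (t.graft f) fun p hp => ?_
  rw [betaFun_mk_apply _ _ _ _ _ hp]
  rw [leaves_graft _ _ hf] at hp
  have hi' : i < f.length := by rw [hf]; exact hi
  have hle := offset_succ f i hi'
  have hle' := offset_le f (i + 1)
  have hl : ((p.drop (offset f i)).take (tree f i).leaves).length = (tree f i).leaves := by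
    rw [List.length_take, List.length_drop]; omega
  rw [graft_graft _ _ _ hf hp, betaFun_mk_apply _ _ _ _ _ (by rw [length_comp, hf]),
    tree_comp _ _ _ hi', offset_comp _ _ _ hi'.le hp, betaFun_mk_apply _ _ _ _ _ hl,
    tree_take_drop _ _ hj, offset_add, offset_take _ hj.le, Nat.add_assoc]

theorem betaFun_extreme_graft (χ : Extremity) (t : FSTree P) (f : List (FSTree P))
    (hf : f.length = t.leaves) (w : LimitSpace P) :
    betaFun (.extreme χ (t.graft f)) w = betaFun (.extreme χ t)
      (betaFun (.extreme χ (tree f (χ.idx t.leaves))) w) := by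
  have e := idx_leaves χ f (by rw [hf]; exact t.leaves_pos)
  rw [hf, ← leaves_graft t f hf] at e
  have h1 := χ.idx_lt (t.graft f).leaves_pos
  rw [e] at h1
  refine Eq.trans ?_ (betaFun_graft t f hf _ _ (χ.idx_lt t.leaves_pos)
    (χ.idx_lt (FSTree.leaves_pos _)) h1 w)
  exact congrArg (fun a => betaFun a w) (PointedTree.ext rfl e)

theorem betaFun_extreme_extremity (χ : Extremity) (t : FSTree P) :
    betaFun (.extreme χ t) (extremity P χ) = extremity P χ := by
  refine ext_above t fun p hp => (betaFun_mk_apply _ _ _ _ p hp).trans ?_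
  rw [extremity_apply, extremity_apply, leaves_graft _ _ hp,
    idx_leaves χ p (by rw [hp]; exact t.leaves_pos), hp]

theorem betaFun_extreme_triv (χ : Extremity) (w : LimitSpace P) :
    betaFun (.extreme χ (FSTree.triv P)) w = w := by
  have : PointedTree.extreme χ (FSTree.triv P) = 1 := PointedTree.ext rfl (by simp; rfl)
  rw [this]
  exact congrFun (map_one (beta (P := P))) w

/-- The sets of points taking the same leaf of a tree as `x` form a basis of neighbourhoods
of `x`. -/
theorem eventually_nhds_iff (x : LimitSpace P) (Q : LimitSpace P → Prop) :
    (∀ᶠ y in nhds x, Q y) ↔ ∃ t : FSTree P, ∀ y : LimitSpace P, y.1 t = x.1 t → Q y := by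
  constructor
  · intro h
    -- A basic open set of the product constrains finitely many coordinates. Trees are directed
    -- under refinement, and the value at a refinement determines the values below, so one
    -- coordinate suffices.
    have h1 : ∀ I : Finset (FSTree P), ∃ t : FSTree P,
        ∀ y : LimitSpace P, y.1 t = x.1 t → ∀ u ∈ I, y.1 u = x.1 u := by
      intro I
      induction I using Finset.cons_induction with
      | empty => exact ⟨FSTree.triv P, by simp⟩
      | cons u I _ ih =>
        obtain ⟨t, ht⟩ := ih
        obtain ⟨p, q, hp, hq, e⟩ := common_tree t u
        refine ⟨t.graft p, fun y hy v hv => ?_⟩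
        rcases Finset.mem_cons.1 hv with rfl | hv
        · rw [e] at hy
          exact Fin.ext (by rw [← x.2 v q hq, ← y.2 v q hq, hy])
        · exact ht y (Fin.ext (by rw [← x.2 t p hp, ← y.2 t p hp, hy])) v hv
    have h2 : nhds x = Filter.comap Subtype.val (nhds x.1) := nhds_induced _ _
    rw [Filter.Eventually, h2] at h
    obtain ⟨U, hU, hUQ⟩ := Filter.mem_comap.1 h
    rw [nhds_pi, Filter.mem_pi] at hU
    obtain ⟨I, hI, V, hV, hVU⟩ := hU
    obtain ⟨t, ht⟩ := h1 hI.toFinset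
    refine ⟨t, fun y hy => hUQ (hVU fun u hu => ?_)⟩
    rw [ht y hy u (hI.mem_toFinset.2 hu)]
    exact mem_of_mem_nhds (hV u)
  · rintro ⟨t, ht⟩
    exact (eventually_apply_eq t x).mono ht

end Ore

end LimitSpace

/-- A leaf-preserving equivalence relation on free trees that contains the skein relations and is
stable under grafting contains the skein congruence. -/
theorem SkeinEq.forall₂_of_congruence {S : Type u} {P : SkeinPresentation S}
    {r : FreeTree S → FreeTree S → Prop} (hr : Equivalence r)
    (hrel : ∀ {t s}, P.rel t s → r t s) (hleaves : ∀ {t s}, r t s → t.leaves = s.leaves)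
    (hgraft : ∀ {t s g g'}, r t s → List.Forall₂ r g g' → g.length = t.leaves →
      r (t.graft g) (s.graft g')) {f g : List (FreeTree S)} (h : SkeinEq P f g) :
    List.Forall₂ r f g := by
  induction h with
  | rel h => exact .cons (hrel h) .nil
  | refl f => exact List.forall₂_same.2 fun t _ => hr.refl t
  | symm _ ih => exact ih.flip.imp fun _ _ h => hr.symm h
  | trans _ _ ih1 ih2 =>
    clear * - ih1 ih2 hr
    rename_i f g h
    induction ih1 generalizing h with
    | nil => exact ih2
    | cons h1 _ ih =>
      cases ih2 with
      | cons h2 h3 => exact .cons (hr.trans h1 h2) (ih h3)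
  | comp _ _ h ih1 ih2 =>
    clear * - ih1 ih2 h hleaves hgraft
    rename_i f f' g g'
    induction ih1 generalizing g g' with
    | nil => exact .nil
    | cons h1 _ ih =>
      simp only [FreeForest.leaves_cons] at h
      simp only [FreeForest.comp]
      rw [← hleaves h1]
      refine .cons (hgraft h1 (List.forall₂_take _ ih2) ?_) (ih ?_ (List.forall₂_drop _ ih2))
      · rw [List.length_take]; omega
      · rw [List.length_drop]; omega
  | tensor _ _ ih1 ih2 => exact List.rel_append ih1 ih2

/-! ## The groups of colour words -/

section Prune

variable {S : Type u} {P : SkeinPresentation S}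

/-- The path to the extreme leaf of `t ∘ g` runs through `t` to its extreme leaf and continues in
the tree glued there. -/
theorem FreeTree.prune_graft (χ : Extremity) (t : FreeTree S) (g : List (FreeTree S))
    (h : g.length = t.leaves) :
    (t.graft g).prune χ = t.prune χ ++ (g.getD (χ.idx t.leaves) .triv).prune χ := by
  induction t generalizing g with
  | triv =>
    match g, h with
    | [a], _ => simp [FreeTree.graft, FreeTree.prune, FreeTree.leaves]
  | caret a l r hl hr =>
    simp only [FreeTree.leaves] at h
    have e1 : (g.take l.leaves).length = l.leaves := by rw [List.length_take]; omega
    have e2 : (g.drop l.leaves).length = r.leaves := by rw [List.length_drop]; omega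
    have p1 := l.leaves_pos
    have p2 := r.leaves_pos
    cases χ with
    | min =>
      simp only [FreeTree.graft, FreeTree.prune, hl _ e1, List.cons_append,
        Extremity.idx, List.getD_eq_getElem?_getD, List.getElem?_take_of_lt p1]
    | max =>
      simp only [FreeTree.graft, FreeTree.prune, hr _ e2, List.cons_append, FreeTree.leaves,
        Extremity.idx, List.getD_eq_getElem?_getD, List.getElem?_drop,
        show l.leaves + (r.leaves - 1) = l.leaves + r.leaves - 1 by omega]

theorem pruneElt_graft (χ : Extremity) (t : FreeTree S) (g : List (FreeTree S))
    (h : g.length = t.leaves) :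
    pruneElt P χ (t.graft g)
      = pruneElt P χ t * pruneElt P χ (g.getD (χ.idx t.leaves) .triv) := by
  simp only [pruneElt, FreeTree.prune_graft χ t g h, List.map_append, List.prod_append]

theorem pruneElt_eq_of_rel (χ : Extremity) {t s : FreeTree S} (h : P.rel t s) :
    pruneElt P χ t = pruneElt P χ s := by
  have h1 := PresentedGroup.one_of_mem (rels := {r : FreeGroup S | ∃ t s : FreeTree S, P.rel t s ∧
    r = ((t.prune χ).map FreeGroup.of).prod * (((s.prune χ).map FreeGroup.of).prod)⁻¹})
    ⟨t, s, h, rfl⟩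
  rw [map_mul, map_inv, mul_inv_eq_one, map_list_prod, map_list_prod, List.map_map,
    List.map_map] at h1
  exact h1

theorem pruneElt_eq_of_skeinEq (χ : Extremity) {t s : FreeTree S} (h : SkeinEq P [t] [s]) :
    pruneElt P χ t = pruneElt P χ s := by
  have := h.forall₂_of_congruence
    -- The number of leaves has to be carried along, because it gives the index of the tree glued at
    -- the last leaf.
    (r := fun t s => t.leaves = s.leaves ∧ pruneElt P χ t = pruneElt P χ s)
    ⟨fun _ => ⟨rfl, rfl⟩, fun h => ⟨h.1.symm, h.2.symm⟩,
      fun h h' => ⟨h.1.trans h'.1, h.2.trans h'.2⟩⟩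
    (fun h => ⟨P.leaves_eq h, pruneElt_eq_of_rel χ h⟩) (fun h => h.1)
    (fun {t s g g'} h hg hl => by
      have hl' : g'.length = s.leaves := by rw [← hg.length_eq, hl, h.1]
      have hg' : ∀ i, (g.getD i .triv).leaves = (g'.getD i .triv).leaves ∧
          pruneElt P χ (g.getD i .triv) = pruneElt P χ (g'.getD i .triv) := by
        clear hl hl'
        intro i
        induction hg generalizing i with
        | nil => exact ⟨rfl, rfl⟩
        | cons h _ ih =>
          cases i with
          | zero => exact h
          | succ i => exact ih i
      have hs : FreeForest.leaves g = FreeForest.leaves g' := by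
        clear hl hl' hg'
        induction hg with
        | nil => rfl
        | cons h _ ih => simp [h.1, ih]
      refine ⟨?_, ?_⟩
      · rw [FreeForest.leaves_graft _ _ hl, FreeForest.leaves_graft _ _ hl', hs]
      · rw [pruneElt_graft χ t g hl, pruneElt_graft χ s g' hl', h.2, h.1, (hg' _).2])
  rw [List.forall₂_cons] at this
  exact this.1.2

/-- The element of the presented group given by the word of colours read from the root to the
first (resp. last) leaf of a tree. -/
def pruneClass (χ : Extremity) : FSTree P → PruneGroup P χ :=
  Quotient.lift (s := treeSetoid P) (pruneElt P χ) fun _ _ h => pruneElt_eq_of_skeinEq χ h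

@[simp] theorem pruneClass_mk (χ : Extremity) (t : FreeTree S) :
    pruneClass χ (FSTree.mk P t) = pruneElt P χ t := rfl

theorem pruneClass_graft (χ : Extremity) (t : FSTree P) (g : List (FSTree P))
    (h : g.length = t.leaves) : pruneClass χ (t.graft g)
      = pruneClass χ t * pruneClass χ (Forest.tree g (χ.idx t.leaves)) := by
  obtain ⟨g, rfl⟩ : ∃ g', List.map (FSTree.mk P) g' = g := ⟨_, Forest.mk_rep g⟩
  induction t using FSTree.ind with | _ t
  rw [List.length_map] at h
  have e : Forest.tree (g.map (FSTree.mk P)) (χ.idx t.leaves)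
      = FSTree.mk P (g.getD (χ.idx t.leaves) .triv) := by
    simp only [Forest.tree, FSTree.triv, List.getD_eq_getElem?_getD, List.getElem?_map]
    cases g[χ.idx t.leaves]? <;> rfl
  rw [Forest.graft_mk t g h, pruneClass_mk, pruneElt_graft χ t g h, FSTree.leaves_mk, e]
  rfl

end Prune

/-! ## Quotients of forest-skein categories -/

section Quotients

variable {S : Type u} {P P' : SkeinPresentation S}

theorem SkeinEq.mono (h : ∀ {t s}, P.rel t s → P'.rel t s) {f g : List (FreeTree S)}
    (hfg : SkeinEq P f g) : SkeinEq P' f g := by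
  induction hfg with
  | rel h' => exact .rel (h h')
  | refl f => exact .refl f
  | symm _ ih => exact .symm ih
  | trans _ _ ih1 ih2 => exact .trans ih1 ih2
  | comp _ _ h ih1 ih2 => exact .comp ih1 ih2 h
  | tensor _ _ ih1 ih2 => exact .tensor ih1 ih2

/-- The quotient map on trees given by additional skein relations. -/
def FSTree.mapOfLE (h : ∀ {t s}, P.rel t s → P'.rel t s) : FSTree P → FSTree P' :=
  Quotient.map (sa := treeSetoid P) (sb := treeSetoid P') id fun _ _ e => SkeinEq.mono h e

theorem FSTree.map_mapOfLE_map_mk (h : ∀ {t s}, P.rel t s → P'.rel t s)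
    (f : List (FreeTree S)) :
    (f.map (FSTree.mk P)).map (FSTree.mapOfLE h) = f.map (FSTree.mk P') := by
  rw [List.map_map]; rfl

/-- The quotient functor given by additional skein relations. -/
def FSMorphism.ofLE (h : ∀ {t s}, P.rel t s → P'.rel t s) : FSMorphism P P' where
  map f := ⟨f.1.map (FSTree.mapOfLE h), by rw [List.length_map, f.2.1], by
    obtain ⟨f, hf1, hf2⟩ := f
    obtain ⟨f, rfl⟩ : ∃ f', List.map (FSTree.mk P) f' = f := ⟨_, Forest.mk_rep f⟩
    rw [FSTree.map_mapOfLE_map_mk, Forest.leaves_map_mk, ← hf2, Forest.leaves_map_mk]⟩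
  map_id n := Subtype.ext (List.map_replicate (f := FSTree.mapOfLE h) (a := FSTree.triv P))
  map_comp f g := Subtype.ext (by
    change (Forest.comp f.1 g.1).map (FSTree.mapOfLE h)
      = Forest.comp (f.1.map (FSTree.mapOfLE h)) (g.1.map (FSTree.mapOfLE h))
    obtain ⟨f, hf1, hf2⟩ := f
    obtain ⟨g, hg1, hg2⟩ := g
    obtain ⟨f, rfl⟩ : ∃ f', List.map (FSTree.mk P) f' = f := ⟨_, Forest.mk_rep f⟩
    obtain ⟨g, rfl⟩ : ∃ g', List.map (FSTree.mk P) g' = g := ⟨_, Forest.mk_rep g⟩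
    have hl : g.length = FreeForest.leaves f := by
      rw [← Forest.leaves_map_mk (P := P), hf2, ← hg1, List.length_map]
    simp only [FSTree.map_mapOfLE_map_mk, Forest.comp_mk _ _ hl])
  map_tensor f g := Subtype.ext List.map_append

theorem FSMorphism.ofLE_surjective (h : ∀ {t s}, P.rel t s → P'.rel t s) (m n : ℕ) :
    Function.Surjective ((FSMorphism.ofLE h).map (m := m) (n := n)) := by
  rintro ⟨f, hf1, hf2⟩
  obtain ⟨f, rfl⟩ : ∃ f', List.map (FSTree.mk P') f' = f := ⟨_, Forest.mk_rep f⟩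
  rw [Forest.leaves_map_mk] at hf2
  rw [List.length_map] at hf1
  exact ⟨⟨f.map (FSTree.mk P), by rw [List.length_map, hf1], by rw [Forest.leaves_map_mk, hf2]⟩,
    Subtype.ext (FSTree.map_mapOfLE_map_mk h f)⟩

/-- The trees of the left factor prescribe where `p` and `q` are cut, so cancellation can be done
one tree at a time. -/
theorem isLeftCancellative_of_graft
    (h : ∀ (t : FSTree P) (p q : List (FSTree P)), p.length = t.leaves → q.length = t.leaves →
      t.graft p = t.graft q → p = q) : IsLeftCancellative (FSCat P) where
  left_cancel := by
    rintro a b c ⟨f, hf1, hf2⟩ ⟨p, hp1, hp2⟩ ⟨q, hq1, hq2⟩ e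
    have e' : Forest.comp f p = Forest.comp f q := congrArg Subtype.val e
    refine Subtype.ext (?_ : p = q)
    have hp : p.length = Forest.leaves f := by rw [hp1, hf2]
    have hq : q.length = Forest.leaves f := by rw [hq1, hf2]
    clear * - e' hp hq h
    induction f generalizing p q with
    | nil =>
      rw [List.length_eq_zero_iff.1 hp, List.length_eq_zero_iff.1 hq]
    | cons t f ih =>
      simp only [Forest.leaves_cons] at hp hq
      simp only [Forest.comp, List.cons.injEq] at e'
      rw [← List.take_append_drop t.leaves p, ← List.take_append_drop t.leaves q,
        h t _ _ (by rw [List.length_take]; omega) (by rw [List.length_take]; omega) e'.1,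
        ih _ _ e'.2 (by rw [List.length_drop]; omega) (by rw [List.length_drop]; omega)]

end Quotients

/-! ### Simplicity: a tree is determined by its cones. -/

namespace LimitSpace

open Forest

variable {S : Type u} {P : SkeinPresentation S}

/-- An adjunction between `offset` and `root`; through it the root map determines the sizes of all
trees of a forest. -/
theorem offset_le_iff (p : List (FSTree P)) {i k : ℕ} (hi : i ≤ p.length) (hk : k < leaves p) :
    offset p i ≤ k ↔ i ≤ root p k := by
  constructor
  · intro h
    obtain ⟨m, rfl⟩ := Nat.exists_eq_add_of_le h
    rw [root_offset_add _ _ _ hi]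
    exact Nat.le_add_right _ _
  · intro h
    by_contra! h'
    have h1 := root_lt (p.take i) k h'
    rw [← root_take _ _ _ h', List.length_take] at h1
    omega

theorem offset_eq_of_root_eq {p q : List (FSTree P)} (hl : p.length = q.length)
    (hs : leaves p = leaves q) (h : ∀ k < leaves p, root p k = root q k) {i : ℕ}
    (hi : i ≤ p.length) : offset p i = offset q i := by
  have h1 := offset_le p i
  have h2 := offset_le q i
  by_contra hne
  rcases Nat.lt_or_gt_of_ne hne with h' | h'
  -- The leaf numbered `offset p i` would have root at least `i` in `p` but smaller than `i` in `q`.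
  · have := (offset_le_iff p hi (by omega)).1 (le_refl (offset p i))
    rw [h _ (by omega), ← offset_le_iff q (by omega) (by omega)] at this
    omega
  · have := (offset_le_iff q (by omega) (by omega)).1 (le_refl (offset q i))
    rw [← h _ (by omega), ← offset_le_iff p (by omega) (by omega)] at this
    omega

variable [OreCategory (FSCat P)]

/-- Two trees with the same number of leaves are related if their corresponding leaves give the
same transformations of the space. -/
def SameCones (t s : FSTree P) : Prop :=
  t.leaves = s.leaves ∧ ∀ (i : ℕ) (ht : i < t.leaves) (hs : i < s.leaves),
    betaFun ⟨t, i, ht⟩ = betaFun ⟨s, i, hs⟩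

namespace SameCones

theorem refl (t : FSTree P) : SameCones t t := ⟨rfl, fun _ _ _ => rfl⟩

theorem symm {t s : FSTree P} (h : SameCones t s) : SameCones s t :=
  ⟨h.1.symm, fun i ht hs => (h.2 i hs ht).symm⟩

theorem trans {t s r : FSTree P} (h : SameCones t s) (h' : SameCones s r) : SameCones t r :=
  ⟨h.1.trans h'.1, fun i ht hs =>
    (h.2 i ht (lt_of_lt_of_eq ht h.1)).trans (h'.2 i (lt_of_lt_of_eq ht h.1) hs)⟩

theorem tree {f g : List (FSTree P)} (h : List.Forall₂ SameCones f g) (i : ℕ) :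
    SameCones (tree f i) (tree g i) := by
  induction h generalizing i with
  | nil => exact refl _
  | cons h _ ih =>
    cases i with
    | zero => exact h
    | succ i => exact ih i

theorem offset {f g : List (FSTree P)} (h : List.Forall₂ SameCones f g) (i : ℕ) :
    offset f i = offset g i := by
  induction h generalizing i with
  | nil => simp [Forest.offset]
  | cons h _ ih =>
    cases i with
    | zero => rfl
    | succ i =>
      have := ih i
      simp only [Forest.offset, List.take_succ_cons, leaves_cons] at this ⊢
      rw [h.1, this]

theorem leaves {f g : List (FSTree P)} (h : List.Forall₂ SameCones f g) :
    leaves f = leaves g := by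
  induction h with
  | nil => rfl
  | cons h _ ih => simp [h.1, ih]

/-- A leaf of `t ∘ f` is a leaf `m` of some tree `i` of `f`, and its cone is the composite of the
cones at `(t, i)` and `(tree f i, m)`; each factor may be replaced by its partner. -/
theorem graft {t s : FSTree P} {f g : List (FSTree P)} (h : SameCones t s)
    (hfg : List.Forall₂ SameCones f g) (hf : f.length = t.leaves) :
    SameCones (t.graft f) (s.graft g) := by
  have hg : g.length = s.leaves := by rw [← hfg.length_eq, hf, h.1]
  refine ⟨by rw [leaves_graft _ _ hf, leaves_graft _ _ hg, leaves hfg], fun k h1 h2 => ?_⟩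
  obtain ⟨m, hm, e⟩ := exists_offset_add f k (lt_of_lt_of_eq h1 (leaves_graft _ _ hf))
  have hi := root_lt f k (lt_of_lt_of_eq h1 (leaves_graft _ _ hf))
  generalize root f k = i at *
  subst e
  funext w
  rw [betaFun_graft t f hf i m (by omega) hm]
  have e2 : Forest.offset f i + m = Forest.offset g i + m := by rw [offset hfg]
  have e3 : (⟨s.graft g, Forest.offset f i + m, h2⟩ : PointedTree P)
      = ⟨s.graft g, Forest.offset g i + m, e2 ▸ h2⟩ := PointedTree.ext rfl e2
  have hm' : m < (Forest.tree g i).leaves := by rw [← (tree hfg i).1]; exact hm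
  rw [e3, betaFun_graft s g hg i m (by have := h.1; omega) hm',
    h.2 i _ (by have := h.1; omega), (tree hfg i).2 m hm hm']

/-- Left cancellation for the cone relation. The cone at leaf `k` of `t ∘ p` lies over leaf `root p
k` of `t`, so equal cones give equal root maps and hence trees of equal sizes in `p` and `q`. The
embeddings at the leaves of `t` can then be cancelled. -/
theorem of_graft {t : FSTree P} {p q : List (FSTree P)} (hp : p.length = t.leaves)
    (hq : q.length = t.leaves) (h : SameCones (t.graft p) (t.graft q)) :
    List.Forall₂ SameCones p q := by
  have hs : Forest.leaves p = Forest.leaves q := by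
    rw [← leaves_graft _ _ hp, h.1, leaves_graft _ _ hq]
  have hroot : ∀ k < Forest.leaves p, root p k = root q k := by
    intro k hk
    have h1 : k < (t.graft p).leaves := by rwa [leaves_graft _ _ hp]
    have h2 : k < (t.graft q).leaves := by rwa [leaves_graft _ _ hq, ← hs]
    -- The extremity serves only as a test point in the cone; any point would do.
    have e1 := betaFun_apply_tree ⟨t.graft p, k, h1⟩ (extremity P .min)
    have e2 := betaFun_apply_tree ⟨t.graft q, k, h2⟩ (extremity P .min)
    rw [← h.2 k h1 h2] at e2
    have e3 := (betaFun ⟨t.graft p, k, h1⟩ (extremity P .min)).2 t p hp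
    have e4 := (betaFun ⟨t.graft p, k, h1⟩ (extremity P .min)).2 t q hq
    simp only at e1 e2
    rw [e1] at e3
    rw [e2] at e4
    rw [e3, e4]
  have hoff := fun {i} => offset_eq_of_root_eq (i := i) (hp.trans hq.symm) hs hroot
  refine List.forall₂_iff_get.2 ⟨hp.trans hq.symm, fun i h1 h2 => ?_⟩
  have t1 : p.get ⟨i, h1⟩ = Forest.tree p i := by
    rw [Forest.tree, List.getD_eq_getElem _ _ h1]; rfl
  have t2 : q.get ⟨i, h2⟩ = Forest.tree q i := by
    rw [Forest.tree, List.getD_eq_getElem _ _ h2]; rfl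
  rw [t1, t2]
  have o1 := hoff h1.le
  have o2 := hoff (i := i + 1) h1
  have o3 := offset_succ p i h1
  have o4 := offset_succ q i h2
  have hl : (Forest.tree p i).leaves = (Forest.tree q i).leaves := by omega
  -- Composing with the embedding at leaf `i` of `t` gives the cones of `t ∘ p` and `t ∘ q` at the
  -- same leaf, since the offsets agree.
  refine ⟨hl, fun j hj hj' => funext fun w => betaFun_injective ⟨t, i, by omega⟩ ?_⟩
  have h3 : Forest.offset p i + j < (t.graft p).leaves := by
    rw [leaves_graft _ _ hp]; exact offset_add_lt _ _ _ h1 hj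
  have h4 : Forest.offset q i + j < (t.graft q).leaves := by
    rw [leaves_graft _ _ hq]; exact offset_add_lt _ _ _ h2 hj'
  have e3 : (⟨t.graft q, Forest.offset p i + j, h.1 ▸ h3⟩ : PointedTree P)
      = ⟨t.graft q, Forest.offset q i + j, h4⟩ := PointedTree.ext rfl (congrArg (· + j) o1)
  rw [← betaFun_graft t p hp i j _ hj h3, ← betaFun_graft t q hq i j _ hj' h4,
    h.2 _ h3 (h.1 ▸ h3), e3]

end SameCones

variable (P) in
/-- The skein presentation in which all trees with the same cones are identified. -/
def coneSkein : SkeinPresentation S where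
  rel t s := SameCones (FSTree.mk P t) (FSTree.mk P s)
  leaves_eq h := h.1

/-- `SameCones` is already a congruence, so imposing it as a set of skein relations identifies no
further trees. -/
theorem mk_coneSkein_eq_iff {t s : FreeTree S} :
    FSTree.mk (coneSkein P) t = FSTree.mk (coneSkein P) s
      ↔ SameCones (FSTree.mk P t) (FSTree.mk P s) := by
  rw [FSTree.mk_eq_mk]
  refine ⟨fun h => ?_, fun h => .rel h⟩
  have := h.forall₂_of_congruence
    (r := fun t s => SameCones (FSTree.mk P t) (FSTree.mk P s))
    ⟨fun _ => .refl _, .symm, .trans⟩ id (fun h => h.1)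
    (fun {t s g g'} h hg hl => by
      have h1 : List.Forall₂ SameCones (g.map (FSTree.mk P)) (g'.map (FSTree.mk P)) := by
        rwa [List.forall₂_map_left_iff, List.forall₂_map_right_iff]
      have h2 := SameCones.graft h h1 (by simpa using hl)
      have hl' : g'.length = s.leaves := by
        rw [← hg.length_eq, hl]; exact h.1
      rwa [graft_mk _ _ hl, graft_mk _ _ hl'] at h2)
  simpa using this

theorem isLeftCancellative_coneSkein : IsLeftCancellative (FSCat (coneSkein P)) := by
  refine isLeftCancellative_of_graft fun t p q hp hq h => ?_
  obtain ⟨p, rfl⟩ : ∃ p', List.map (FSTree.mk (coneSkein P)) p' = p := ⟨_, Forest.mk_rep p⟩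
  obtain ⟨q, rfl⟩ : ∃ q', List.map (FSTree.mk (coneSkein P)) q' = q := ⟨_, Forest.mk_rep q⟩
  induction t using FSTree.ind with | _ t
  rw [List.length_map] at hp hq
  rw [graft_mk t p hp, graft_mk t q hq, mk_coneSkein_eq_iff, ← graft_mk t p hp,
    ← graft_mk t q hq] at h
  have h1 := SameCones.of_graft (by simpa using hp) (by simpa using hq) h
  rw [List.forall₂_map_left_iff, List.forall₂_map_right_iff] at h1
  rw [← List.forall₂_eq_eq_eq, List.forall₂_map_left_iff, List.forall₂_map_right_iff]
  exact h1.imp fun _ _ => mk_coneSkein_eq_iff.2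

/-- In a simple Ore forest-skein category, a tree is determined by the transformations given by
its leaves. -/
theorem eq_of_sameCones (hP : P.IsSimple) {t s : FSTree P} (h : SameCones t s) : t = s := by
  have hle : ∀ {t s}, P.rel t s → (coneSkein P).rel t s := fun {t s} h => by
    have : FSTree.mk P t = FSTree.mk P s := FSTree.mk_eq_mk.2 (.rel h)
    change SameCones _ _
    rw [this]
    exact .refl _
  -- The quotient by `SameCones` is left-cancellative, so simplicity makes the quotient functor
  -- injective; it is used on the morphisms from `1`, which are trees.
  have hinj := hP S (coneSkein P) (FSMorphism.ofLE hle) (FSMorphism.ofLE_surjective hle)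
    isLeftCancellative_coneSkein 1 s.leaves
  have e : FSCat.ofTree t h.1 = FSCat.ofTree s rfl := by
    refine hinj (Subtype.ext (congrArg (fun a => [a])
      (?_ : FSTree.mapOfLE hle t = FSTree.mapOfLE hle s)))
    induction t using FSTree.ind with | _ t
    induction s using FSTree.ind with | _ s
    exact mk_coneSkein_eq_iff.2 h
  exact congrArg FSCat.toTree e

/-- In a common refinement `t ∘ p = s ∘ q`, the trees of `p` and `q` over the distinguished leaves
turn out to be equal. Their common word is then cancelled in the group. -/
theorem pruneClass_eq_of_betaFun_eq (hP : P.IsSimple) (χ : Extremity) {t s : FSTree P}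
    (h : betaFun (.extreme χ t) = betaFun (.extreme χ s)) : pruneClass χ t = pruneClass χ s := by
  obtain ⟨p, q, hp, hq, e⟩ := common_tree t s
  -- On the common tree, the images of `o` and `ω` pick the first and the last leaf over the
  -- distinguished leaf. Computed through `t` and through `s`, they show that both subtrees occupy
  -- the same interval of leaves.
  have key : ∀ ξ : Extremity, offset p (χ.idx t.leaves) + ξ.idx (tree p (χ.idx t.leaves)).leaves
      = offset q (χ.idx s.leaves) + ξ.idx (tree q (χ.idx s.leaves)).leaves := by
    intro ξ
    rw [← extremity_apply ξ, ← extremity_apply ξ]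
    refine (betaFun_apply (.extreme χ t) (extremity P ξ) p hp).symm.trans
      (Eq.trans ?_ (betaFun_apply (.extreme χ s) (extremity P ξ) q hq))
    rw [h]
    exact congrArg (fun u => ((betaFun (.extreme χ s) (extremity P ξ)).1 u : ℕ)) e
  have kmin := key .min
  have kmax := key .max
  change _ + 0 = _ + 0 at kmin
  change _ + (_ - 1) = _ + (_ - 1) at kmax
  have h1 := (tree p (χ.idx t.leaves)).leaves_pos
  have h2 := (tree q (χ.idx s.leaves)).leaves_pos
  -- Corresponding leaves of the two subtrees are one leaf of the common tree; cancelling `β(t, χ) =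
  -- β(s, χ)` from its cone leaves equal cones.
  have huv : tree p (χ.idx t.leaves) = tree q (χ.idx s.leaves) := by
    refine eq_of_sameCones hP ⟨by omega, fun j hj hj' => funext fun w =>
      betaFun_injective (.extreme χ t) ?_⟩
    have h3 : offset p (χ.idx t.leaves) + j < (t.graft p).leaves := by
      rw [leaves_graft _ _ hp]
      exact offset_add_lt _ _ _ (by rw [hp]; exact χ.idx_lt t.leaves_pos) hj
    have h4 : offset q (χ.idx s.leaves) + j < (s.graft q).leaves := by
      rw [leaves_graft _ _ hq]
      exact offset_add_lt _ _ _ (by rw [hq]; exact χ.idx_lt s.leaves_pos) hj'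
    have e1 := betaFun_graft t p hp _ j (χ.idx_lt t.leaves_pos) hj h3 w
    have e2 := betaFun_graft s q hq _ j (χ.idx_lt s.leaves_pos) hj' h4 w
    refine e1.symm.trans (Eq.trans ?_ (e2.trans (congrFun h _).symm))
    exact congrArg (fun a => betaFun a w) (PointedTree.ext e (by simp only; omega))
  have e3 := pruneClass_graft χ t p hp
  rw [e, pruneClass_graft χ s q hq, huv] at e3
  exact (mul_right_cancel e3).symm

end LimitSpace

/-! ## Fractions in Ore monoids -/

namespace MonoidFrac

variable {M : Type u} [Monoid M] [OreMonoid M]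

/-- The canonical morphism from an Ore monoid to its fraction group. -/
def of : M →* MonoidFrac M where
  toFun x := mk x 1
  map_one' := rfl
  map_mul' x y := by
    refine (FracGroup.mk_mul_mk (D := OneObject M) (d := ⟨⟩) (x := ⟨⟩) (y := ⟨⟩) (z := ⟨⟩)
      (f := x) (g := (1 : M)) (h := y) (k := (1 : M)) (p := y) (q := (1 : M)) ?_).trans ?_ |>.symm
    · exact (one_mul y).trans (mul_one y).symm
    · exact congrArg (fun z => mk (x * y) z) (mul_one (1 : M))

theorem of_mul_inv_of (x y : M) : of x * (of y)⁻¹ = mk x y := by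
  refine (FracGroup.mk_mul_mk (D := OneObject M) (d := ⟨⟩) (x := ⟨⟩) (y := ⟨⟩) (z := ⟨⟩)
    (f := x) (g := (1 : M)) (h := (1 : M)) (k := y) (p := (1 : M)) (q := (1 : M)) rfl).trans ?_
  exact FracGroup.mk_expand (D := OneObject M) (d := ⟨⟩) (x := ⟨⟩) (z := ⟨⟩) x y (1 : M)

/-- Right cancellation is not assumed, so `of` need not be injective and the factor `p` has to stay.
-/
theorem of_eq_of {x y : M} : of x = of y ↔ ∃ p : M, x * p = y * p := by
  refine (FracGroup.mk_eq_mk (D := OneObject M) (d := ⟨⟩) (x := ⟨⟩) (y := ⟨⟩)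
    (f := x) (g := (1 : M)) (f' := y) (g' := (1 : M))).trans ⟨?_, ?_⟩
  · rintro ⟨_, p, q, h1, h2⟩
    have h3 : p = q := (one_mul p).symm.trans (Eq.trans h2 (one_mul q))
    subst h3
    exact ⟨p, h1⟩
  · rintro ⟨p, h⟩
    exact ⟨⟨⟩, p, p, h, rfl⟩

theorem exists_of_mul_inv_of (g : MonoidFrac M) : ∃ x y : M, g = of x * (of y)⁻¹ := by
  induction g using FracGroup.ind with | _ z x y
  exact ⟨x, y, (of_mul_inv_of (M := M) x y).symm⟩

end MonoidFrac

/-! ### The Ore monoid at an end, and the morphisms to and from the presented group. -/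

namespace LimitSpace

open Forest

variable {S : Type u} {P : SkeinPresentation S}

theorem mk_caret (a : S) (l r : FreeTree S) :
    FSTree.mk P (.caret a l r)
      = (FSTree.mk P (.caret a .triv .triv)).graft [FSTree.mk P l, FSTree.mk P r] :=
  (graft_mk (FreeTree.caret a .triv .triv) [l, r] rfl).symm

variable [OreCategory (FSCat P)]

/-- The transformation given by a tree pointed at its first (resp. last) leaf. -/
noncomputable def extremeBeta (χ : Extremity) (t : FSTree P) : betaMonoid P χ :=
  ⟨beta (.extreme χ t), Submonoid.mem_map_of_mem _ (mem_extremePointedTrees.2 rfl)⟩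

theorem exists_extremeBeta {χ : Extremity} (x : betaMonoid P χ) : ∃ t, extremeBeta χ t = x := by
  obtain ⟨_, a, ha, rfl⟩ := x
  exact ⟨a.tree, Subtype.ext (congrArg beta (eq_extreme (mem_extremePointedTrees.1 ha)).symm)⟩

theorem extremeBeta_eq_iff {χ : Extremity} {t s : FSTree P} :
    extremeBeta χ t = extremeBeta χ s ↔ betaFun (.extreme χ t) = betaFun (.extreme χ s) :=
  Subtype.ext_iff

theorem extremeBeta_graft (χ : Extremity) (t : FSTree P) (f : List (FSTree P))
    (hf : f.length = t.leaves) : extremeBeta χ (t.graft f)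
      = extremeBeta χ t * extremeBeta χ (tree f (χ.idx t.leaves)) :=
  Subtype.ext (funext fun w => betaFun_extreme_graft χ t f hf w)

theorem extremeBeta_mul (χ : Extremity) (t s : FSTree P) :
    extremeBeta χ t * extremeBeta χ s
      = extremeBeta χ (t.graft (single t.leaves (χ.idx t.leaves) s)) := by
  rw [extremeBeta_graft _ _ _ (length_single (χ.idx_lt t.leaves_pos) s), tree_single]

theorem extremeBeta_triv (χ : Extremity) : extremeBeta χ (FSTree.triv P) = 1 :=
  Subtype.ext (funext fun w => betaFun_extreme_triv χ w)

/-- The monoid of transformations given by trees pointed at their first (resp. last) leaf is an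
Ore monoid. -/
theorem oreMonoid_betaMonoid (χ : Extremity) : OreMonoid (betaMonoid P χ) where
  left_cancel := by
    intro _ _ _ f p q h
    obtain ⟨t, rfl⟩ := exists_extremeBeta (P := P) (χ := χ) f
    -- An injective transformation can be cancelled on the left.
    refine Subtype.ext (funext fun w => betaFun_injective (.extreme χ t) ?_)
    exact congrFun (congrArg Subtype.val h) w
  common_right_multiple := by
    intro _ _ _ g h
    obtain ⟨t, rfl⟩ := exists_extremeBeta (P := P) (χ := χ) g
    obtain ⟨s, rfl⟩ := exists_extremeBeta (P := P) (χ := χ) h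
    -- Only the trees of `p` and `q` over the extreme leaves matter; they complete `t` and `s` to a
    -- common multiple.
    obtain ⟨p, q, hp, hq, e⟩ := common_tree t s
    refine ⟨⟨⟩, extremeBeta χ (tree p (χ.idx t.leaves)),
      extremeBeta χ (tree q (χ.idx s.leaves)), ?_⟩
    exact (extremeBeta_graft χ t p hp).symm.trans
      ((congrArg _ e).trans (extremeBeta_graft χ s q hq))

instance (χ : Extremity) : OreMonoid (betaMonoid P χ) := oreMonoid_betaMonoid χ

theorem betaCaret_eq (χ : Extremity) (a : S) :
    betaCaret P χ a = extremeBeta χ (FSTree.mk P (.caret a .triv .triv)) := by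
  cases χ <;> rfl

/-- Peel off the root caret: the subtree away from the end has no effect on the transformation, and
the one at the end contributes the rest of the word. -/
theorem extremeBeta_mk (χ : Extremity) (t : FreeTree S) :
    extremeBeta χ (FSTree.mk P t) = ((t.prune χ).map (betaCaret P χ)).prod := by
  induction t with
  | triv => exact extremeBeta_triv χ
  | caret a l r hl hr =>
    rw [mk_caret, extremeBeta_graft _ _ _ rfl]
    cases χ with
    | min => rw [FreeTree.prune, List.map_cons, List.prod_cons, ← hl, betaCaret_eq]; rfl
    | max => rw [FreeTree.prune, List.map_cons, List.prod_cons, ← hr, betaCaret_eq]; rfl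

variable (P) in
/-- The morphism from the presented group to the fraction group induced by the carets. -/
noncomputable def kappaHom (χ : Extremity) : PruneGroup P χ →* MonoidFrac (betaMonoid P χ) :=
  PresentedGroup.toGroup (f := fun a => MonoidFrac.of (betaCaret P χ a)) (by
    rintro _ ⟨t, s, h, rfl⟩
    -- The image of the word of `t` depends only on the class of `t` in the forest-skein category,
    -- so the defining relators die.
    have key : ∀ t : FreeTree S, FreeGroup.lift (fun a => MonoidFrac.of (betaCaret P χ a))
        ((t.prune χ).map FreeGroup.of).prod = MonoidFrac.of (extremeBeta χ (FSTree.mk P t)) := by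
      intro t
      rw [extremeBeta_mk, map_list_prod, map_list_prod, List.map_map, List.map_map]
      congr 2
      funext a
      simp
    rw [map_mul, map_inv, key, key, FSTree.mk_eq_mk.2 (.rel h), mul_inv_cancel])

theorem kappaHom_of (χ : Extremity) (a : S) :
    kappaHom P χ (PresentedGroup.of a) = MonoidFrac.of (betaCaret P χ a) :=
  PresentedGroup.toGroup.of _

theorem kappaHom_pruneClass (χ : Extremity) (t : FSTree P) :
    kappaHom P χ (pruneClass χ t) = MonoidFrac.of (extremeBeta χ t) := by
  induction t using FSTree.ind with | _ t
  rw [pruneClass_mk, pruneElt, extremeBeta_mk, map_list_prod, map_list_prod, List.map_map,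
    List.map_map]
  congr 2
  funext a
  exact kappaHom_of χ a

theorem kappaHom_surjective (χ : Extremity) : Function.Surjective (kappaHom P χ) := by
  intro g
  obtain ⟨x, y, rfl⟩ := MonoidFrac.exists_of_mul_inv_of g
  obtain ⟨t, rfl⟩ := exists_extremeBeta x
  obtain ⟨s, rfl⟩ := exists_extremeBeta y
  exact ⟨pruneClass χ t * (pruneClass χ s)⁻¹, by
    rw [map_mul, map_inv, kappaHom_pruneClass, kappaHom_pruneClass]⟩

variable (P) in
/-- The morphism reading the words of colours of pairs of trees. -/
noncomputable def pruneHom (χ : Extremity) : FSGroup P →* PruneGroup P χ where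
  toFun := Quotient.lift (s := fracSetoid (⟨1⟩ : FSCat P))
    (fun a => pruneClass χ (FSCat.toTree a.num) * (pruneClass χ (FSCat.toTree a.den))⁻¹) (by
      -- Expanding by `p` prolongs both words by that of the same tree of `p`, because numerator and
      -- denominator have equally many leaves; the two contributions cancel.
      have key : ∀ (a : FracPair (⟨1⟩ : FSCat P)) (z : FSCat P) (p : a.obj ⟶ z),
          pruneClass χ (FSCat.toTree (a.num ≫ p)) * (pruneClass χ (FSCat.toTree (a.den ≫ p)))⁻¹
            = pruneClass χ (FSCat.toTree a.num) * (pruneClass χ (FSCat.toTree a.den))⁻¹ := by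
        intro a z p
        rw [FSCat.toTree_comp, FSCat.toTree_comp,
          pruneClass_graft _ _ _ (by rw [FSCat.leaves_toTree]; exact p.2.1),
          pruneClass_graft _ _ _ (by rw [FSCat.leaves_toTree]; exact p.2.1),
          FSCat.leaves_toTree, FSCat.leaves_toTree]
        group
      rintro a b ⟨z, p, q, h1, h2⟩
      rw [← key a z p, ← key b z q, h1, h2])
  map_one' := mul_inv_cancel _
  map_mul' a b := by
    induction a using FracGroup.ind with | _ x f g
    induction b using FracGroup.ind with | _ y h k
    obtain ⟨z, p, q, e⟩ := OreCategory.common_right_multiple g h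
    rw [FracGroup.mk_mul_mk e, ← FracGroup.mk_expand f g p, ← FracGroup.mk_expand h k q, e]
    change pruneClass χ (FSCat.toTree (f ≫ p)) * (pruneClass χ (FSCat.toTree (k ≫ q)))⁻¹
      = pruneClass χ (FSCat.toTree (f ≫ p)) * (pruneClass χ (FSCat.toTree (h ≫ q)))⁻¹
        * (pruneClass χ (FSCat.toTree (h ≫ q)) * (pruneClass χ (FSCat.toTree (k ≫ q)))⁻¹)
    group

theorem pruneHom_mk (χ : Extremity) {n : ℕ} (t s : FSTree P) (ht : t.leaves = n)
    (hs : s.leaves = n) : pruneHom P χ (FracGroup.mk (FSCat.ofTree t ht) (FSCat.ofTree s hs))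
      = pruneClass χ t * (pruneClass χ s)⁻¹ := rfl

theorem _root_.FSGroup.exists_eq_mk (g : FSGroup P) :
    ∃ (n : ℕ) (t s : FSTree P) (ht : t.leaves = n) (hs : s.leaves = n),
      g = FracGroup.mk (FSCat.ofTree t ht) (FSCat.ofTree s hs) := by
  induction g using FracGroup.ind with | _ x f g
  refine ⟨x.num, FSCat.toTree f, FSCat.toTree g, FSCat.leaves_toTree f, FSCat.leaves_toTree g, ?_⟩
  congr 1
  · exact Subtype.ext (FSCat.val_eq f)
  · exact Subtype.ext (FSCat.val_eq g)

end LimitSpace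

/-- The caret with a given tree at its first (resp. last) leaf. -/
def FreeTree.extremeCaret {S : Type u} (χ : Extremity) (a : S) (u v : FreeTree S) : FreeTree S :=
  match χ with
  | .min => .caret a u v
  | .max => .caret a v u

theorem FreeTree.leaves_extremeCaret {S : Type u} (χ : Extremity) (a : S) (u v : FreeTree S) :
    (extremeCaret χ a u v).leaves = u.leaves + v.leaves := by
  cases χ
  · rfl
  · exact Nat.add_comm _ _

theorem FreeTree.prune_extremeCaret {S : Type u} (χ : Extremity) (a : S) (u v : FreeTree S) :
    (extremeCaret χ a u v).prune χ = a :: u.prune χ := by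
  cases χ <;> rfl

/-! ### The isomorphism with the fraction group, and the germs of the `F`-type group. -/

namespace LimitSpace

variable {S : Type u} {P : SkeinPresentation S} [OreCategory (FSCat P)]

theorem pruneHom_surjective (χ : Extremity) : Function.Surjective (pruneHom P χ) := by
  rw [← MonoidHom.range_eq_top, eq_top_iff, ← PresentedGroup.closure_range_of,
    Subgroup.closure_le]
  rintro _ ⟨a, rfl⟩
  -- Two trees with three leaves each: the word of `t` is `a a` and that of `s` is `a`, so their
  -- fraction maps to the generator `a`.
  let c : FreeTree S := .extremeCaret χ a .triv .triv
  let t : FreeTree S := .extremeCaret χ a c .triv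
  let s : FreeTree S := .extremeCaret χ a .triv c
  have hc : c.leaves = 2 := FreeTree.leaves_extremeCaret _ _ _ _
  have ht : t.leaves = 3 := (FreeTree.leaves_extremeCaret _ _ _ _).trans (by rw [hc]; rfl)
  have hs : s.leaves = 3 := (FreeTree.leaves_extremeCaret _ _ _ _).trans (by rw [hc]; rfl)
  refine ⟨FracGroup.mk (FSCat.ofTree (FSTree.mk P t) ht) (FSCat.ofTree (FSTree.mk P s) hs), ?_⟩
  refine (pruneHom_mk χ (FSTree.mk P t) (FSTree.mk P s) ht hs).trans ?_
  rw [pruneClass_mk, pruneClass_mk]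
  simp [pruneElt, t, s, c, FreeTree.prune_extremeCaret, FreeTree.prune]

/-- Surjectivity of `prune` lets every element be written with two trees `t`, `s`. If its image is
trivial, `t` and `s` give the same transformation once both are prolonged at the end by some `c`, so
the prolonged words agree and that of `c` cancels. -/
theorem kappaHom_injective (hP : P.IsSimple) (χ : Extremity) :
    Function.Injective (kappaHom P χ) := by
  rw [injective_iff_map_eq_one]
  intro g hg
  obtain ⟨g, rfl⟩ := pruneHom_surjective χ g
  obtain ⟨n, t, s, ht, hs, rfl⟩ := FSGroup.exists_eq_mk g
  rw [pruneHom_mk] at hg ⊢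
  rw [map_mul, map_inv, kappaHom_pruneClass, kappaHom_pruneClass, mul_inv_eq_one,
    MonoidFrac.of_eq_of] at hg
  obtain ⟨x, hx⟩ := hg
  obtain ⟨c, rfl⟩ := exists_extremeBeta x
  rw [extremeBeta_mul, extremeBeta_mul, extremeBeta_eq_iff] at hx
  have h := pruneClass_eq_of_betaFun_eq hP χ hx
  rw [pruneClass_graft _ _ _ (Forest.length_single (χ.idx_lt t.leaves_pos) c),
    pruneClass_graft _ _ _ (Forest.length_single (χ.idx_lt s.leaves_pos) c),
    Forest.tree_single, Forest.tree_single] at h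
  rw [mul_right_cancel h, mul_inv_cancel]

/-- The isomorphism from the presented group to the fraction group induced by the carets. -/
noncomputable def kappa (hP : P.IsSimple) (χ : Extremity) :
    PruneGroup P χ ≃* MonoidFrac (betaMonoid P χ) :=
  MulEquiv.ofBijective (kappaHom P χ) ⟨kappaHom_injective hP χ, kappaHom_surjective χ⟩

theorem canonicalAction_mk_betaFun {n : ℕ} (t s : FSTree P) (ht : t.leaves = n)
    (hs : s.leaves = n) (j : ℕ) (hj : j < n) (w : LimitSpace P) :
    canonicalAction P (FracGroup.mk (FSCat.ofTree t ht) (FSCat.ofTree s hs))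
        (betaFun ⟨s, j, lt_of_lt_of_eq hj hs.symm⟩ w)
      = betaFun ⟨t, j, lt_of_lt_of_eq hj ht.symm⟩ w :=
  ext_above t fun p hp => (alphaFun_apply t s (ht.trans hs.symm) _ p hp).trans
    ((betaFun_mk_apply _ _ _ _ _ (hp.trans (ht.trans hs.symm))).trans
      (betaFun_mk_apply _ _ _ _ _ hp).symm)

theorem canonicalAction_mk_extreme (χ : Extremity) {n : ℕ} (t s : FSTree P) (ht : t.leaves = n)
    (hs : s.leaves = n) (w : LimitSpace P) :
    canonicalAction P (FracGroup.mk (FSCat.ofTree t ht) (FSCat.ofTree s hs))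
      (betaFun (.extreme χ s) w) = betaFun (.extreme χ t) w := by
  subst hs
  refine (canonicalAction_mk_betaFun t s ht rfl _ (χ.idx_lt s.leaves_pos) w).trans ?_
  exact congrArg (fun a => betaFun a w) (PointedTree.ext rfl (by simp [ht]))

/-- The element `[t, s]` exchanges the extreme cones of `s` and `t`, and both embeddings fix the
extremity. -/
theorem canonicalAction_extremity (χ : Extremity) (g : FSGroup P) :
    canonicalAction P g (extremity P χ) = extremity P χ := by
  obtain ⟨n, t, s, ht, hs, rfl⟩ := FSGroup.exists_eq_mk g
  have := canonicalAction_mk_extreme χ t s ht hs (extremity P χ)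
  rwa [betaFun_extreme_extremity, betaFun_extreme_extremity] at this

/-- A property holds near an extremity when it holds on the cone at the first (resp. last) leaf of
some tree. -/
theorem eventually_extremity_iff (χ : Extremity) (Q : LimitSpace P → Prop) :
    (∀ᶠ y in nhds (extremity P χ), Q y) ↔ ∃ t : FSTree P, ∀ w, Q (betaFun (.extreme χ t) w) := by
  rw [eventually_nhds_iff]
  refine exists_congr fun t => ⟨fun h w => h _ (Fin.ext ?_), fun h y hy => ?_⟩
  · rw [extremity_apply]
    exact betaFun_apply_tree (.extreme χ t) w
  · obtain ⟨w, rfl⟩ := exists_betaFun_eq (.extreme χ t) y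
      ((congrArg Fin.val hy).trans (extremity_apply χ t))
    exact h w

/-- The germ at an extremity is determined by the fraction of the two cones. -/
theorem kappaHom_pruneHom_eq_one_iff (χ : Extremity) (g : FSGroup P) :
    kappaHom P χ (pruneHom P χ g) = 1 ↔
      ∀ᶠ y in nhds (extremity P χ), canonicalAction P g y = y := by
  obtain ⟨n, t, s, ht, hs, rfl⟩ := FSGroup.exists_eq_mk g
  rw [pruneHom_mk, map_mul, map_inv, kappaHom_pruneClass, kappaHom_pruneClass, mul_inv_eq_one,
    MonoidFrac.of_eq_of, eventually_extremity_iff]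
  constructor
  · rintro ⟨x, hx⟩
    obtain ⟨c, rfl⟩ := exists_extremeBeta x
    -- The cone of `s` prolonged by `c`: there the action replaces `β(s, χ)` by `β(t, χ)`, which
    -- agree after `β(c, χ)`.
    refine ⟨s.graft (Forest.single s.leaves (χ.idx s.leaves) c), fun w => ?_⟩
    rw [betaFun_extreme_graft _ _ _ (Forest.length_single (χ.idx_lt s.leaves_pos) c),
      Forest.tree_single, canonicalAction_mk_extreme]
    exact congrFun (congrArg Subtype.val hx) w
  · rintro ⟨u, hu⟩
    -- The extreme cone of a common refinement lies in the cone of `s`, where the action is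
    -- explicit, and in that of `u`, where it is trivial.
    obtain ⟨p, q, hp, hq, e⟩ := common_tree s u
    refine ⟨extremeBeta χ (Forest.tree p (χ.idx s.leaves)), Subtype.ext (funext fun w => ?_)⟩
    have h := hu (betaFun (.extreme χ (Forest.tree q (χ.idx u.leaves))) w)
    rw [← betaFun_extreme_graft _ _ _ hq, ← e, betaFun_extreme_graft _ _ _ hp,
      canonicalAction_mk_extreme] at h
    exact h

/-- The isomorphism from the germ group of the forest-skein group to the fraction group. -/
theorem exists_germ_equiv (hP : P.IsSimple) (χ : Extremity) :
    ∃ e : Germ (canonicalAction P) (extremity P χ) ≃* MonoidFrac (betaMonoid P χ),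
      ∀ (g : FSGroup P) (hg : canonicalAction P g (extremity P χ) = extremity P χ),
        e (Germ.mk (canonicalAction P) (extremity P χ) g hg)
          = kappa hP χ (pruneHom P χ g) := by
  let θ : germStabilizer (canonicalAction P) (extremity P χ) →* MonoidFrac (betaMonoid P χ) :=
    ((kappaHom P χ).comp (pruneHom P χ)).comp (Subgroup.subtype _)
  have hθ : Function.Surjective θ := fun x => by
    obtain ⟨g, rfl⟩ := ((kappaHom_surjective χ).comp (pruneHom_surjective χ)) x
    exact ⟨⟨g, canonicalAction_extremity χ g⟩, rfl⟩
  have hker : germKernel (canonicalAction P) (extremity P χ) = θ.ker :=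
    Subgroup.ext fun g => (kappaHom_pruneHom_eq_one_iff χ g.1).symm
  exact ⟨(QuotientGroup.quotientMulEquivOfEq hker).trans
    (QuotientGroup.quotientKerEquivOfSurjective θ hθ), fun g hg => rfl⟩

end LimitSpace

/-! ## Comparison of germ groups -/

section GermComparison

variable {Γ : Type u} [Group Γ] {Γ' : Type v} [Group Γ'] {Z : Type w} [TopologicalSpace Z]

/-- The morphism from the germ group of an action to the germ group of all homeomorphisms. -/
def Germ.toHomeomorph (η : Γ →* (Z ≃ₜ Z)) (z : Z) :
    Germ η z →* Germ (MonoidHom.id (Z ≃ₜ Z)) z :=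
  QuotientGroup.map (germKernel η z) (germKernel (MonoidHom.id (Z ≃ₜ Z)) z)
    ((η.comp (Subgroup.subtype _)).codRestrict (germStabilizer (MonoidHom.id (Z ≃ₜ Z)) z)
      fun g => g.2) fun _ hg => hg

theorem Germ.toHomeomorph_mk (η : Γ →* (Z ≃ₜ Z)) (z : Z) (g : Γ) (hg : η g z = z) :
    Germ.toHomeomorph η z (Germ.mk η z g hg) = Germ.mk (MonoidHom.id _) z (η g) hg := rfl

theorem Germ.exists_mk (η : Γ →* (Z ≃ₜ Z)) (z : Z) (x : Germ η z) :
    ∃ (g : Γ) (hg : η g z = z), x = Germ.mk η z g hg := by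
  obtain ⟨⟨g, hg⟩, rfl⟩ := QuotientGroup.mk_surjective x
  exact ⟨g, hg, rfl⟩

/-- Whether a germ is trivial depends only on the homeomorphism. All germ groups at `z` thus embed
in that of the full homeomorphism group, where they can be compared as subgroups. -/
theorem Germ.toHomeomorph_injective (η : Γ →* (Z ≃ₜ Z)) (z : Z) :
    Function.Injective (Germ.toHomeomorph η z) := by
  intro x y h
  obtain ⟨g, hg, rfl⟩ := Germ.exists_mk η z x
  obtain ⟨g', hg', rfl⟩ := Germ.exists_mk η z y
  rw [toHomeomorph_mk, toHomeomorph_mk, Germ.mk_eq_mk] at h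
  exact (Germ.mk_eq_mk _ _ _ _).2 h

theorem Germ.range_toHomeomorph_le {η : Γ →* (Z ≃ₜ Z)} {η' : Γ' →* (Z ≃ₜ Z)} {z : Z}
    (h : ∀ g, η g z = z → ∃ g', η' g' z = z ∧ ∀ᶠ y in nhds z, η g y = η' g' y) :
    (Germ.toHomeomorph η z).range ≤ (Germ.toHomeomorph η' z).range := by
  rintro _ ⟨x, rfl⟩
  obtain ⟨g, hg, rfl⟩ := Germ.exists_mk η z x
  obtain ⟨g', hg', e⟩ := h g hg
  refine ⟨Germ.mk η' z g' hg', ?_⟩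
  rw [toHomeomorph_mk, toHomeomorph_mk, Germ.mk_eq_mk]
  exact e.mono fun y hy => hy.symm

/-- Two actions with the same germs at a point have isomorphic germ groups. -/
theorem Germ.nonempty_mulEquiv {η : Γ →* (Z ≃ₜ Z)} {η' : Γ' →* (Z ≃ₜ Z)} {z : Z}
    (h : ∀ g, η g z = z → ∃ g', η' g' z = z ∧ ∀ᶠ y in nhds z, η g y = η' g' y)
    (h' : ∀ g', η' g' z = z → ∃ g, η g z = z ∧ ∀ᶠ y in nhds z, η' g' y = η g y) :
    Nonempty (Germ η z ≃* Germ η' z) :=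
  ⟨(MonoidHom.ofInjective (Germ.toHomeomorph_injective η z)).trans
    ((MulEquiv.subgroupCongr (le_antisymm (Germ.range_toHomeomorph_le h)
      (Germ.range_toHomeomorph_le h'))).trans
      (MonoidHom.ofInjective (Germ.toHomeomorph_injective η' z)).symm)⟩

end GermComparison

theorem exists_finRotate_pow_eq {n : ℕ} (hn : 2 ≤ n) (i j : Fin n) :
    ∃ k : ℕ, (finRotate n ^ k) i = j := by
  obtain ⟨m, rfl⟩ := Nat.exists_eq_add_of_le' hn
  have h : ∀ i : Fin (m + 2), finRotate (m + 2) i ≠ i := fun i => by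
    rw [← Equiv.Perm.mem_support, support_finRotate]; exact Finset.mem_univ i
  exact isCycle_finRotate.exists_pow_eq (h i) (h j)

/-- A tree with `m + 1` leaves. -/
def FreeTree.comb {S : Type u} (a : S) : ℕ → FreeTree S
  | 0 => .triv
  | m + 1 => .caret a .triv (comb a m)

theorem FreeTree.leaves_comb {S : Type u} (a : S) (m : ℕ) : (comb a m).leaves = m + 1 := by
  induction m with
  | zero => rfl
  | succ m ih => rw [comb, leaves, ih, leaves, Nat.add_comm]

theorem FreeTree.eq_triv {S : Type u} [IsEmpty S] (t : FreeTree S) : t = .triv := by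
  cases t with
  | triv => rfl
  | caret a => exact isEmptyElim a

/-! ### Germs of the `T`- and `V`-type groups and of their commutator subgroups. -/

namespace LimitSpace

open Forest

variable {S : Type u} {P : SkeinPresentation S}

/-- The degenerate case without colours, treated apart because padding a tree requires a caret. -/
theorem subsingleton [IsEmpty S] : Subsingleton (LimitSpace P) := by
  refine ⟨fun x y => Subtype.ext (funext fun t => Fin.ext ?_)⟩
  have h : t.leaves = 1 := by
    induction t using FSTree.ind with | _ t
    rw [t.eq_triv]; rfl
  have h1 := (x.1 t).2
  have h2 := (y.1 t).2
  omega

theorem leaves_graft_single_add_one {t : FSTree P} {i : ℕ} (hi : i < t.leaves) (s : FSTree P) :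
    (t.graft (single t.leaves i s)).leaves + 1 = t.leaves + s.leaves := by
  rw [leaves_graft _ _ (length_single hi s), leaves_single]
  omega

variable [OreCategory (FSCat P)]

theorem betaFun_mul (a b : PointedTree P) (w : LimitSpace P) :
    betaFun (a * b) w = betaFun a (betaFun b w) :=
  congrFun (map_mul (beta (P := P)) a b) w

/-- Overlapping cones have a common subcone. -/
theorem exists_common_cone {a b : PointedTree P} {w v : LimitSpace P}
    (h : betaFun a w = betaFun b v) : ∃ (c d : PointedTree P) (x : LimitSpace P),
      betaFun c x = w ∧ ∀ y, betaFun a (betaFun c y) = betaFun b (betaFun d y) := by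
  obtain ⟨t, i, hi⟩ := a
  obtain ⟨s, j, hj⟩ := b
  obtain ⟨p, q, hp, hq, e⟩ := common_tree t s
  -- The point `β(t, i)(w)` takes, on `t ∘ p`, the leaf of the `i`th tree of `p` chosen by `w`; the
  -- cone there is a subcone of the cone at `(t, i)`.
  have key : ∀ (t : FSTree P) (i : ℕ) (hi : i < t.leaves) (w : LimitSpace P) (p : List (FSTree P)),
      p.length = t.leaves → ∃ c : PointedTree P, ∀ (h : _) (y : LimitSpace P),
        betaFun ⟨t.graft p, (betaFun ⟨t, i, hi⟩ w).1 (t.graft p), h⟩ y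
          = betaFun ⟨t, i, hi⟩ (betaFun c y) := by
    intro t i hi w p hp
    refine ⟨⟨tree p i, w.1 (tree p i), (w.1 _).2⟩, fun h y => ?_⟩
    have e := betaFun_mk_apply t i hi w p hp
    rw [← betaFun_graft t p hp i _ hi (w.1 _).2 (e ▸ h)]
    exact congrArg (fun a => betaFun a y) (PointedTree.ext rfl e)
  obtain ⟨c, hc⟩ := key t i hi w p hp
  obtain ⟨d, hd⟩ := key s j hj v q hq
  -- Both subcones are the cone at the leaf of the common tree that the common point chooses.
  have h1 : ∀ y, betaFun ⟨t, i, hi⟩ (betaFun c y) = betaFun ⟨s, j, hj⟩ (betaFun d y) := fun y => by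
    rw [← hc ((betaFun ⟨t, i, hi⟩ w).1 _).2, ← hd ((betaFun ⟨s, j, hj⟩ v).1 _).2]
    refine congrArg (fun a => betaFun a y) (PointedTree.ext e ?_)
    rw [← h]
    exact congrArg (fun u => ((betaFun ⟨t, i, hi⟩ w).1 u : ℕ)) e
  obtain ⟨x, hx⟩ := exists_betaFun_eq
    ⟨t.graft p, (betaFun ⟨t, i, hi⟩ w).1 (t.graft p), ((betaFun ⟨t, i, hi⟩ w).1 _).2⟩ _ rfl
  exact ⟨c, d, x, betaFun_injective _ ((hc _ x).symm.trans hx), h1⟩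

/-- Every transformation in the `V`-type group locally replaces a cone by another. -/
theorem exists_cones_of_mem_canonicalGroupV {φ : LimitSpace P ≃ₜ LimitSpace P}
    (hφ : φ ∈ canonicalGroupV P) (x : LimitSpace P) : ∃ (a b : PointedTree P) (w : LimitSpace P),
      betaFun a w = x ∧ ∀ v, φ (betaFun a v) = betaFun b v := by
  induction hφ using Subgroup.closure_induction generalizing x with
  | mem φ h =>
    obtain ⟨n, t, s, ht, hs, π, h⟩ := h
    obtain ⟨w, hw⟩ := exists_betaFun_eq ⟨s, x.1 s, (x.1 s).2⟩ x rfl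
    exact ⟨_, _, w, hw, h ⟨x.1 s, lt_of_lt_of_eq (x.1 s).2 hs⟩⟩
  | one => exact ⟨1, 1, x, congrFun (map_one (beta (P := P))) x, fun v => rfl⟩
  | mul φ ψ _ _ ih1 ih2 =>
    obtain ⟨a, b, w, hw, h⟩ := ih2 x
    obtain ⟨a', b', w', hw', h'⟩ := ih1 (betaFun b w)
    -- The target cone of `ψ` and the source cone of `φ` both contain `ψ x`; on a common subcone the
    -- two replacements compose.
    obtain ⟨c, d, y, hy, hcd⟩ := exists_common_cone hw'.symm
    refine ⟨a * c, b' * d, y, by rw [betaFun_mul, hy, hw], fun v => ?_⟩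
    change φ (ψ _) = _
    rw [betaFun_mul, betaFun_mul, h, hcd, h']
  | inv φ _ ih =>
    obtain ⟨a, b, w, hw, h⟩ := ih (φ.symm x)
    refine ⟨b, a, w, ?_, fun v => ?_⟩
    · rw [← h, hw, φ.apply_symm_apply]
    · change φ.symm _ = _
      rw [← h, φ.symm_apply_apply]

/-- A point of the space without its first part. -/
noncomputable def tail (t : FSTree P) (x : LimitSpace P) : LimitSpace P :=
  (exists_betaFun_eq ⟨t, x.1 t, (x.1 t).2⟩ x rfl).choose

theorem betaFun_tail (t : FSTree P) (x : LimitSpace P) :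
    betaFun ⟨t, x.1 t, (x.1 t).2⟩ (tail t x) = x :=
  (exists_betaFun_eq ⟨t, x.1 t, (x.1 t).2⟩ x rfl).choose_spec

/-- Cones at distinct leaves of one tree are disjoint, since a point records its leaf in its value
at the tree. -/
theorem betaFun_eq_imp {t : FSTree P} {i j : ℕ} {hi : i < t.leaves} {hj : j < t.leaves}
    {w v : LimitSpace P} (h : betaFun ⟨t, i, hi⟩ w = betaFun ⟨t, j, hj⟩ v) : i = j ∧ w = v := by
  have h1 := betaFun_apply_tree ⟨t, i, hi⟩ w
  have h2 := betaFun_apply_tree ⟨t, j, hj⟩ v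
  rw [h] at h1
  obtain rfl : i = j := h1.symm.trans h2
  exact ⟨rfl, betaFun_injective _ h⟩

/-- The transformation permuting the cones at the leaves of a tree. -/
noncomputable def permFun (t : FSTree P) (π : Equiv.Perm (Fin t.leaves)) (x : LimitSpace P) :
    LimitSpace P :=
  betaFun ⟨t, π (x.1 t), (π (x.1 t)).2⟩ (tail t x)

theorem permFun_betaFun (t : FSTree P) (π : Equiv.Perm (Fin t.leaves)) (j : Fin t.leaves)
    (w : LimitSpace P) :
    permFun t π (betaFun ⟨t, j, j.2⟩ w) = betaFun ⟨t, π j, (π j).2⟩ w := by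
  obtain ⟨h1, h2⟩ := betaFun_eq_imp (betaFun_tail t (betaFun ⟨t, j, j.2⟩ w))
  rw [permFun, h2]
  exact congrArg (fun a => betaFun a w) (PointedTree.ext rfl
    (congrArg (fun i => (π i : ℕ)) (Fin.ext h1)))

theorem permFun_permFun (t : FSTree P) (π ρ : Equiv.Perm (Fin t.leaves)) (x : LimitSpace P) :
    permFun t ρ (permFun t π x) = permFun t (ρ * π) x := by
  rw [← betaFun_tail t x, permFun_betaFun, permFun_betaFun, permFun_betaFun]
  rfl

theorem permFun_one (t : FSTree P) (x : LimitSpace P) : permFun t 1 x = x := betaFun_tail t x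

/-- Each coordinate of the image depends locally on only two coordinates of the point. -/
theorem continuous_permFun (t : FSTree P) (π : Equiv.Perm (Fin t.leaves)) :
    Continuous (permFun t π) := by
  refine Continuous.subtype_mk (f := fun x => (permFun t π x).1) (continuous_pi fun u => ?_) _
  refine IsLocallyConstant.continuous (IsLocallyConstant.iff_eventually_eq _ |>.2 fun x => ?_)
  obtain ⟨p, q, hp, hq, e⟩ := common_tree t u
  -- The value of the tail at `v` is visible on `t` with `v` grafted at the leaf chosen by the
  -- point.
  have hv : ∀ (y : LimitSpace P) (v : FSTree P), (y.1 (t.graft (single t.leaves (y.1 t) v)) : ℕ)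
      = y.1 t + (tail t y).1 v := fun y v => by
    have h := betaFun_mk_apply t (y.1 t) (y.1 t).2 (tail t y) _ (length_single (y.1 t).2 v)
    rwa [betaFun_tail, offset_single, tree_single] at h
  -- The first coordinate fixes which cone is moved; the second fixes the tail at the tree of `p`
  -- over the target leaf.
  filter_upwards [eventually_apply_eq t x, eventually_apply_eq
    (t.graft (single t.leaves (x.1 t) (tree p (π (x.1 t))))) x] with y h1 h2
  have h3 : ((tail t y).1 (tree p (π (x.1 t))) : ℕ) = (tail t x).1 (tree p (π (x.1 t))) := by
    have e1 := hv x (tree p (π (x.1 t)))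
    have e2 := hv y (tree p (π (x.1 t)))
    rw [h1, h2] at e2
    omega
  refine Fin.ext ?_
  rw [← (permFun t π y).2 u q hq, ← (permFun t π x).2 u q hq, ← e]
  congr 1
  refine (betaFun_mk_apply _ _ _ _ p hp).trans (Eq.trans ?_ (betaFun_mk_apply _ _ _ _ p hp).symm)
  rw [h1, h3]

/-- The homeomorphism permuting the cones at the leaves of a tree. -/
noncomputable def permHomeo (t : FSTree P) (π : Equiv.Perm (Fin t.leaves)) :
    LimitSpace P ≃ₜ LimitSpace P where
  toFun := permFun t π
  invFun := permFun t π⁻¹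
  left_inv x := by rw [permFun_permFun, inv_mul_cancel, permFun_one]
  right_inv x := by rw [permFun_permFun, mul_inv_cancel, permFun_one]
  continuous_toFun := continuous_permFun t π
  continuous_invFun := continuous_permFun t π⁻¹

theorem permHomeo_mem_canonicalGroupT (t : FSTree P) {π : Equiv.Perm (Fin t.leaves)}
    (hπ : IsCyclicPerm π) : permHomeo t π ∈ canonicalGroupT P :=
  Subgroup.subset_closure ⟨t.leaves, t, t, rfl, rfl, π, hπ, fun j w => permFun_betaFun t π j w⟩

theorem canonicalAction_mem_canonicalGroupT (g : FSGroup P) :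
    canonicalAction P g ∈ canonicalGroupT P := by
  obtain ⟨n, t, s, ht, hs, rfl⟩ := FSGroup.exists_eq_mk g
  exact Subgroup.subset_closure ⟨n, t, s, ht, hs, 1, ⟨0, rfl⟩, fun j w =>
    canonicalAction_mk_betaFun t s ht hs j j.2 w⟩

theorem canonicalGroupT_le_canonicalGroupV : canonicalGroupT P ≤ canonicalGroupV P :=
  Subgroup.closure_mono fun _ ⟨n, t, s, ht, hs, π, _, h⟩ => ⟨n, t, s, ht, hs, π, h⟩

/-- With at least two leaves the two ends of a tree are different leaves, so growth at one is
invisible at the other. This allows the two ends to be adjusted independently. -/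
theorem extremeBeta_graft_single_opp (χ : Extremity) (t s : FSTree P) (ht : 2 ≤ t.leaves) :
    extremeBeta χ (t.graft (single t.leaves (χ.opp.idx t.leaves) s)) = extremeBeta χ t := by
  rw [extremeBeta_graft _ _ _ (length_single (χ.opp.idx_lt t.leaves_pos) s),
    tree_single_of_ne _ (χ.idx_ne_idx_opp ht), extremeBeta_triv, mul_one]

/-- Any two trees have refinements with the same number of leaves which prolong them in the same
way at one end and give the same transformation at the other end. -/
theorem exists_refinements [Nonempty S] (χ : Extremity) (t s : FSTree P) :
    ∃ (x : betaMonoid P χ) (t' s' : FSTree P), t'.leaves = s'.leaves ∧ 2 ≤ s'.leaves ∧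
      extremeBeta χ t' = extremeBeta χ t * x ∧ extremeBeta χ s' = extremeBeta χ s * x ∧
      extremeBeta χ.opp t' = extremeBeta χ.opp s' := by
  obtain ⟨a⟩ := ‹Nonempty S›
  let c : FSTree P := FSTree.mk P (.caret a .triv .triv)
  -- Every pad has the one-letter word `a` at the opposite end, whatever its size, so leaf counts
  -- can be adjusted without changing the transformation there.
  let pad : ℕ → FSTree P := fun m => FSTree.mk P (.extremeCaret χ.opp a .triv (.comb a m))
  have hpad : ∀ m, (pad m).leaves = m + 2 := fun m => by
    refine (FreeTree.leaves_extremeCaret χ.opp a .triv (.comb a m)).trans ?_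
    rw [FreeTree.leaves_comb, FreeTree.leaves]; omega
  have hpad' : ∀ m, extremeBeta χ.opp (pad m) = extremeBeta χ.opp (pad 0) := fun m => by
    rw [extremeBeta_mk, extremeBeta_mk, FreeTree.prune_extremeCaret, FreeTree.prune_extremeCaret]
  let ext : Extremity → FSTree P → FSTree P → FSTree P := fun ξ t s =>
    t.graft (single t.leaves (ξ.idx t.leaves) s)
  have hext : ∀ ξ t s, (ext ξ t s).leaves + 1 = t.leaves + s.leaves := fun ξ t s =>
    leaves_graft_single_add_one (ξ.idx_lt t.leaves_pos) s
  have hmul : ∀ ξ t s, extremeBeta ξ (ext ξ t s) = extremeBeta ξ t * extremeBeta ξ s :=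
    fun ξ t s => (extremeBeta_mul ξ t s).symm
  have hopp : ∀ t s, 2 ≤ t.leaves → extremeBeta χ (ext χ.opp t s) = extremeBeta χ t :=
    fun t s h => extremeBeta_graft_single_opp χ t s h
  have hc : c.leaves = 2 := rfl
  -- Both trees are prolonged by the same caret at the end `χ`, to separate the two ends; this caret
  -- is the common factor `x`.
  have ht1 : 2 ≤ (ext χ t c).leaves := by have := hext χ t c; have := t.leaves_pos; omega
  have hs1 : 2 ≤ (ext χ s c).leaves := by have := hext χ s c; have := s.leaves_pos; omega
  obtain ⟨p, q, hp, hq, e⟩ := common_tree (ext χ t c) (ext χ s c)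
  -- Growing `d` and `d'` at the opposite end makes the two transformations at that end agree.
  let d := tree p (χ.opp.idx (ext χ t c).leaves)
  let d' := tree q (χ.opp.idx (ext χ s c).leaves)
  have hdd : extremeBeta χ.opp (ext χ t c) * extremeBeta χ.opp d
      = extremeBeta χ.opp (ext χ s c) * extremeBeta χ.opp d' := by
    rw [← extremeBeta_graft _ _ _ hp, ← extremeBeta_graft _ _ _ hq, e]
  have l1 := hext χ.opp (ext χ t c) d
  have l2 := hext χ.opp (ext χ s c) d'
  have l3 := d.leaves_pos
  have l4 := d'.leaves_pos
  have l5 := hext χ.opp (ext χ.opp (ext χ t c) d) (pad (ext χ.opp (ext χ s c) d').leaves)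
  have l6 := hext χ.opp (ext χ.opp (ext χ s c) d') (pad (ext χ.opp (ext χ t c) d).leaves)
  rw [hpad] at l5 l6
  -- Each side is padded according to the size of the other, so both totals are the sum of the two
  -- sizes plus one.
  refine ⟨extremeBeta χ c,
    ext χ.opp (ext χ.opp (ext χ t c) d) (pad (ext χ.opp (ext χ s c) d').leaves),
    ext χ.opp (ext χ.opp (ext χ s c) d') (pad (ext χ.opp (ext χ t c) d).leaves),
    by omega, by omega, ?_, ?_, ?_⟩
  · rw [hopp _ _ (by omega), hopp _ _ ht1, hmul]
  · rw [hopp _ _ (by omega), hopp _ _ hs1, hmul]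
  · rw [hmul, hmul, hmul, hmul, hdd, hpad', hpad' (ext χ.opp (ext χ t c) d).leaves]

/-- Near the end, `φ` replaces a cone `a` by a cone `b`. Both contain the fixed extremity, hence are
extreme. Prolonging both by the same `x` to trees with equally many leaves gives a fraction in `G`
with this germ. -/
theorem exists_germ_eq_of_mem_canonicalGroupV (χ : Extremity) {φ : LimitSpace P ≃ₜ LimitSpace P}
    (hφ : φ ∈ canonicalGroupV P) (h : φ (extremity P χ) = extremity P χ) :
    ∃ g : FSGroup P, ∀ᶠ y in nhds (extremity P χ), φ y = canonicalAction P g y := by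
  rcases isEmpty_or_nonempty S with hS | hS
  · have := subsingleton (P := P)
    exact ⟨1, .of_forall fun y => Subsingleton.elim _ _⟩
  obtain ⟨a, b, w, hw, hab⟩ := exists_cones_of_mem_canonicalGroupV hφ (extremity P χ)
  have hb : betaFun b w = extremity P χ := by rw [← hab, hw, h]
  have ha' : a.leaf = χ.idx a.tree.leaves := by
    rw [← betaFun_apply_tree a w, hw, extremity_apply]
  have hb' : b.leaf = χ.idx b.tree.leaves := by
    rw [← betaFun_apply_tree b w, hb, extremity_apply]
  obtain ⟨x, t, s, hts, -, ht, hs, -⟩ := exists_refinements χ b.tree a.tree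
  refine ⟨FracGroup.mk (FSCat.ofTree t hts) (FSCat.ofTree s rfl),
    (eventually_extremity_iff χ _).2 ⟨s, fun v => ?_⟩⟩
  rw [canonicalAction_mk_extreme]
  have e1 : betaFun (.extreme χ t) v = betaFun (.extreme χ b.tree) (x.1 v) :=
    congrFun (congrArg Subtype.val ht) v
  have e2 : betaFun (.extreme χ s) v = betaFun (.extreme χ a.tree) (x.1 v) :=
    congrFun (congrArg Subtype.val hs) v
  rw [e1, e2, ← eq_extreme ha', ← eq_extreme hb', hab]

/-- The germ is realised by an `f` that is trivial near the opposite end. Conjugating `f⁻¹` by a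
rotation that moves the end to the opposite one makes it trivial near `χ`, so the commutator keeps
only the germ of `f`. -/
theorem exists_mem_commutator_germ_eq (χ : Extremity) (g : FSGroup P) :
    ∃ φ ∈ ⁅canonicalGroupT P, canonicalGroupT P⁆,
      ∀ᶠ y in nhds (extremity P χ), canonicalAction P g y = φ y := by
  rcases isEmpty_or_nonempty S with hS | hS
  · have := subsingleton (P := P)
    exact ⟨1, one_mem _, .of_forall fun y => Subsingleton.elim _ _⟩
  obtain ⟨n, t, s, ht, hs, rfl⟩ := FSGroup.exists_eq_mk g
  obtain ⟨x, t', s', hts, h2, ht', hs', hopp⟩ := exists_refinements χ t s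
  obtain ⟨k, hk⟩ := exists_finRotate_pow_eq h2 ⟨χ.idx s'.leaves, χ.idx_lt s'.leaves_pos⟩
    ⟨χ.opp.idx s'.leaves, χ.opp.idx_lt s'.leaves_pos⟩
  let g' : FSGroup P := FracGroup.mk (FSCat.ofTree t' hts) (FSCat.ofTree s' rfl)
  let f := canonicalAction P g'
  let h := permHomeo s' (finRotate s'.leaves ^ k)
  have hf1 : ∀ w, f (betaFun (.extreme χ s') w) = betaFun (.extreme χ t') w :=
    canonicalAction_mk_extreme χ t' s' hts rfl
  have hf2 : ∀ w, f (betaFun (.extreme χ.opp s') w) = betaFun (.extreme χ.opp s') w := fun w =>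
    (canonicalAction_mk_extreme χ.opp t' s' hts rfl w).trans
      (congrFun (extremeBeta_eq_iff.1 hopp) w)
  have hh : ∀ w, h (betaFun (.extreme χ s') w) = betaFun (.extreme χ.opp s') w := fun w => by
    refine (permFun_betaFun s' _ ⟨χ.idx s'.leaves, χ.idx_lt s'.leaves_pos⟩ w).trans ?_
    exact congrArg (fun a => betaFun a w) (PointedTree.ext rfl (congrArg Fin.val hk))
  -- On the extreme cone of `s'`, `h` moves to the opposite cone, `f⁻¹` does nothing there, `h⁻¹`
  -- moves back, and finally `f` acts.
  refine ⟨f * h⁻¹ * f⁻¹ * (h⁻¹)⁻¹, Subgroup.commutator_mem_commutator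
    (canonicalAction_mem_canonicalGroupT g')
    (inv_mem (permHomeo_mem_canonicalGroupT s' ⟨k, rfl⟩)),
    (eventually_extremity_iff χ _).2 ⟨s', fun w => ?_⟩⟩
  have e0 : (f * h⁻¹ * f⁻¹ * (h⁻¹)⁻¹) (betaFun (.extreme χ s') w)
      = f (h.symm (f.symm (h (betaFun (.extreme χ s') w)))) := by
    rw [inv_inv]; rfl
  have e3 : f.symm (betaFun (.extreme χ.opp s') w) = betaFun (.extreme χ.opp s') w :=
    f.toEquiv.symm_apply_eq.2 (hf2 w).symm
  have e4 : h.symm (betaFun (.extreme χ.opp s') w) = betaFun (.extreme χ s') w :=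
    h.toEquiv.symm_apply_eq.2 (hh w).symm
  have e1 : betaFun (.extreme χ t') w = betaFun (.extreme χ t) (x.1 w) :=
    congrFun (congrArg Subtype.val ht') w
  have e2 : betaFun (.extreme χ s') w = betaFun (.extreme χ s) (x.1 w) :=
    congrFun (congrArg Subtype.val hs') w
  rw [e0, hh, e3, e4, hf1, e1, e2, canonicalAction_mk_extreme]

/-- All groups between the commutator subgroup of the `T`-type group and the `V`-type group have
the same germs at the extremities as the forest-skein group. -/
theorem nonempty_germ_mulEquiv (χ : Extremity) {Γ : Subgroup (LimitSpace P ≃ₜ LimitSpace P)}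
    (h : ⁅canonicalGroupT P, canonicalGroupT P⁆ ≤ Γ) (h' : Γ ≤ canonicalGroupV P) :
    Nonempty (Germ Γ.subtype (extremity P χ) ≃*
      Germ (canonicalAction P) (extremity P χ)) := by
  refine Germ.nonempty_mulEquiv (fun φ hφ => ?_) fun g hg => ?_
  · obtain ⟨g, e⟩ := exists_germ_eq_of_mem_canonicalGroupV χ (h' φ.2) hφ
    exact ⟨g, canonicalAction_extremity χ g, e⟩
  · obtain ⟨φ, hφ, e⟩ := exists_mem_commutator_germ_eq χ g
    exact ⟨⟨φ, h hφ⟩, e.self_of_nhds.symm.trans hg, e⟩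

end LimitSpace

/-- Let `𝓕 = FS⟨S | R⟩` be a simple Ore forest-skein category, and let `χ` be one of the two ends
`o`, `ω` of the space of its canonical actions. -/
theorem proposition3p3 {S : Type u} (P : SkeinPresentation S) [OreCategory (FSCat P)]
    (hP : P.IsSimple) (χ : Extremity) :
    -- the monoid `β(𝒯_χ)` is an Ore monoid
    (∃ _ : OreMonoid (LimitSpace.betaMonoid P χ),
      ∃ (κ : PruneGroup P χ ≃* MonoidFrac (LimitSpace.betaMonoid P χ))
        (prune : FSGroup P →* PruneGroup P χ)
        (e : Germ (canonicalAction P) (LimitSpace.extremity P χ) ≃*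
          MonoidFrac (LimitSpace.betaMonoid P χ)),
        -- `κ` is the isomorphism induced by `a ↦ β(Y_a, χ)`
        (∀ a : S, κ (PresentedGroup.of a) = MonoidFrac.mk (LimitSpace.betaCaret P χ a) 1) ∧
        -- `prune` is the surjective morphism reading the words of colours of a pair of trees
        (∀ (n : ℕ) (t s : FreeTree S) (ht : t.leaves = n) (hs : s.leaves = n),
          prune (FracGroup.mk (FSCat.ofTree (FSTree.mk P t) ht) (FSCat.ofTree (FSTree.mk P s) hs))
            = pruneElt P χ t * (pruneElt P χ s)⁻¹) ∧
        Function.Surjective prune ∧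
        -- every element of the forest-skein group fixes the end `χ`, and `κ ∘ prune` factors
        -- through the isomorphism `e` of the germ group
        (∀ g : FSGroup P,
          ∃ hg : canonicalAction P g (LimitSpace.extremity P χ) = LimitSpace.extremity P χ,
            e (Germ.mk (canonicalAction P) (LimitSpace.extremity P χ) g hg) = κ (prune g))) ∧
    -- the germ groups at `χ` are all isomorphic to the presented group
    Nonempty (Germ (canonicalAction P) (LimitSpace.extremity P χ) ≃* PruneGroup P χ) ∧
    Nonempty (Germ (canonicalGroupT P).subtype (LimitSpace.extremity P χ) ≃* PruneGroup P χ) ∧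
    Nonempty (Germ (canonicalGroupV P).subtype (LimitSpace.extremity P χ) ≃* PruneGroup P χ) ∧
    Nonempty (Germ ⁅canonicalGroupT P, canonicalGroupT P⁆.subtype (LimitSpace.extremity P χ) ≃*
      PruneGroup P χ) ∧
    Nonempty (Germ ⁅canonicalGroupV P, canonicalGroupV P⁆.subtype (LimitSpace.extremity P χ) ≃*
      PruneGroup P χ) := by
  obtain ⟨e, he⟩ := LimitSpace.exists_germ_equiv hP χ
  have eG : Germ (canonicalAction P) (LimitSpace.extremity P χ) ≃* PruneGroup P χ :=
    e.trans (LimitSpace.kappa hP χ).symm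
  have hTV := LimitSpace.canonicalGroupT_le_canonicalGroupV (P := P)
  -- All four groups lie between the commutator subgroup of the `T`-type group and the `V`-type
  -- group, so one comparison of germs covers them.
  have key : ∀ Γ : Subgroup (LimitSpace P ≃ₜ LimitSpace P),
      ⁅canonicalGroupT P, canonicalGroupT P⁆ ≤ Γ → Γ ≤ canonicalGroupV P →
      Nonempty (Germ Γ.subtype (LimitSpace.extremity P χ) ≃* PruneGroup P χ) := fun Γ h h' =>
    (LimitSpace.nonempty_germ_mulEquiv χ h h').map fun e' => e'.trans eG
  exact ⟨⟨LimitSpace.oreMonoid_betaMonoid χ, LimitSpace.kappa hP χ, LimitSpace.pruneHom P χ, e,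
    LimitSpace.kappaHom_of χ, fun n t s ht hs =>
      LimitSpace.pruneHom_mk χ (FSTree.mk P t) (FSTree.mk P s) ht hs,
    LimitSpace.pruneHom_surjective χ,
    fun g => ⟨LimitSpace.canonicalAction_extremity χ g, he g _⟩⟩, ⟨eG⟩,
    key _ (Subgroup.commutator_le_self _) hTV,
    key _ ((Subgroup.commutator_le_self _).trans hTV) le_rfl,
    key _ le_rfl ((Subgroup.commutator_le_self _).trans hTV),
    key _ (Subgroup.commutator_mono hTV hTV) (Subgroup.commutator_le_self _)⟩
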